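/- Let $X$ be a separable real Banach space which is a Lindenstrauss space, i.e. its dual $X^*$ is linearly isometric to $L_1(\mu)$ for some measure $\mu$. Let $B_{X^*}$ and $S_{X^*}$ be the closed unit ball and the unit sphere of $X^*$, and let $\mathrm{ext}\,B_{X^*}$ be the set of extreme points of $B_{X^*}$. Then the following are equivalent. (i) $X^*$ has the $\sigma(X^*,X)$-fixed point property: for every nonempty, convex, weak$^*$-compact set $K\subseteq X^*$, every map $T:K\to K$ with $\|T(x)-T(y)\|\le\|x-y\|$ for all $x,y\in K$ has a fixed point. (ii) There is no infinite set $C\subseteq \mathrm{ext}\,B_{X^*}$ such that $\overline{\mathrm{conv}(C)}^{\,*}\subseteq S_{X^*}$, where $\overline{\mathrm{conv}(C)}^{\,*}$ is the weak$^*$-closure of the convex hull of $C$. -/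

import Mathlib

open MeasureTheory

universe u v

/-- A real Banach space `X` is a Lindenstrauss space if its dual is linearly isometric to
`L₁(μ)` for some measure `μ` (an arbitrary measure on an arbitrary measurable space). -/
def IsLindenstraussSpace (X : Type u) [NormedAddCommGroup X] [NormedSpace ℝ X] : Prop :=
  ∃ (Ω : Type v) (_ : MeasurableSpace Ω) (μ : Measure Ω),
    Nonempty (StrongDual ℝ X ≃ₗᵢ[ℝ] Lp ℝ 1 μ)

/-- `C` has the fixed point property: each nonexpansive self-map of `C` has a fixed point. -/
def HasFPP {E : Type u} [NormedAddCommGroup E] (C : Set E) : Prop :=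
  ∀ T : C → C, (∀ x y : C, ‖(T x : E) - (T y : E)‖ ≤ ‖(x : E) - (y : E)‖) → ∃ x : C, T x = x

/-- A subset of the dual `X*` is weak-star compact if it is compact for `σ(X*, X)`. -/
def IsWeakStarCompact {X : Type u} [NormedAddCommGroup X] [NormedSpace ℝ X]
    (C : Set (StrongDual ℝ X)) : Prop :=
  IsCompact (StrongDual.toWeakDual '' C)

/-- The closure of a subset of the dual `X*` for `σ(X*, X)`. -/
def weakStarClosure {X : Type u} [NormedAddCommGroup X] [NormedSpace ℝ X]
    (A : Set (StrongDual ℝ X)) : Set (StrongDual ℝ X) :=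
  StrongDual.toWeakDual ⁻¹' closure (StrongDual.toWeakDual '' A)

/-- `X*` has the `σ(X*, X)`-fixed point property: every nonempty, convex, weak-star compact
subset of `X*` has the fixed point property (for maps nonexpansive in the dual norm). -/
def HasWeakStarFPP (X : Type u) [NormedAddCommGroup X] [NormedSpace ℝ X] : Prop :=
  ∀ C : Set (StrongDual ℝ X), C.Nonempty → Convex ℝ C → IsWeakStarCompact C → HasFPP C

/-! A norm-one extreme point of the unit ball of L₁(μ) is carried by an atom, so it spans an
L-summand. Extreme points of the dual ball, one at most from each antipodal pair, therefore behave
like the unit vectors of an ℓ₁ space (`LSystem.ofSet`), even when they do not span.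

If an infinite set C of extreme points has its weak-star closed hull K in the sphere, a sequence
from C acts as an ℓ₁ basis with nonnegative coordinates on K. Shifting these coordinates and giving
the missing mass to the first vector is a nonexpansive self-map of K without fixed points
(`LSystem.not_hasFPP`).

The converse rests on an extraction principle, `LSystem.exists_infinite_subset`: a norm-one v with
nonnegative coordinates that lies in the weak-star closed hull of every cofinite part of the system
yields such a C. There are two sources of v. If there are uncountably many extreme points,
separability makes one of them a weak-star accumulation point of the others, and v is that point. If
there are countably many, they norm X, and a Simons-type argument
(`LSystem.eq_zero_of_coord_eq_zero`) shows that they span, so X* is an ℓ₁ space. For a nonexpansive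
map without fixed points, take a minimal invariant set, approximate fixed points in it and their
coordinatewise limit u. Asymptotic additivity of the ℓ₁ norm puts the minimal set on a sphere
centred at u (`LSystem.exists_center_of_minimal`). If p is the weak-star limit of the approximate
fixed points, then p - u, normalized, is v (`LSystem.exists_infinite_of_sphere`). -/

open Filter Topology

/-! ### L-summands and biorthogonal L-systems -/

/-- A vector `e` spans an `L`-summand of `V`, with coordinate functional `φ`. -/
def IsLAtom {V : Type*} [NormedAddCommGroup V] [NormedSpace ℝ V] (e : V) : Prop :=
  ∃ φ : V →ₗ[ℝ] ℝ, φ e = 1 ∧ ∀ x, ‖x‖ = |φ x| + ‖x - φ x • e‖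

/-- A biorthogonal system of `V` all of whose vectors span `L`-summands. -/
structure LSystem (ι : Type*) (V : Type*) [NormedAddCommGroup V] [NormedSpace ℝ V] where
  vec : ι → V
  coord : ι → V →ₗ[ℝ] ℝ
  coord_self : ∀ i, coord i (vec i) = 1
  coord_ne : ∀ i j, i ≠ j → coord i (vec j) = 0
  norm_eq : ∀ i x, ‖x‖ = |coord i x| + ‖x - coord i x • vec i‖

namespace LSystem

variable {ι V : Type*} [NormedAddCommGroup V] [NormedSpace ℝ V] (S : LSystem ι V)

lemma norm_vec (i : ι) : ‖S.vec i‖ = 1 := by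
  rw [S.norm_eq i (S.vec i), S.coord_self]; simp

lemma abs_coord_le (i : ι) (x : V) : |S.coord i x| ≤ ‖x‖ := by
  rw [S.norm_eq i x]; linarith [norm_nonneg (x - S.coord i x • S.vec i)]

lemma continuous_coord (i : ι) : Continuous (S.coord i) :=
  AddMonoidHomClass.continuous_of_bound (S.coord i) 1 fun x => by
    simpa using S.abs_coord_le i x

lemma vec_injective : Function.Injective S.vec := fun i j h => by
  by_contra hij
  have h1 := S.coord_ne i j hij
  rw [← h, S.coord_self] at h1
  exact one_ne_zero h1

open Classical in
lemma coord_sum (j : ι) (s : Finset ι) (c : ι → ℝ) :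
    S.coord j (∑ i ∈ s, c i • S.vec i) = if j ∈ s then c j else 0 := by
  rw [map_sum]
  split_ifs with h
  · rw [Finset.sum_eq_single_of_mem j h]
    · simp [S.coord_self]
    · intro b _ hb
      simp [S.coord_ne j b hb.symm]
  · refine Finset.sum_eq_zero fun b hb => ?_
    have : j ≠ b := fun e => h (e ▸ hb)
    simp [S.coord_ne j b this]

/-- The summands are peeled off one at a time; by biorthogonality, removing the earlier ones leaves
the next coordinate unchanged. -/
lemma norm_eq_sum (s : Finset ι) (x : V) :
    ‖x‖ = ∑ i ∈ s, |S.coord i x| + ‖x - ∑ i ∈ s, S.coord i x • S.vec i‖ := by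
  classical
  induction s using Finset.induction_on with
  | empty => simp
  | insert j s hj ih =>
    rw [Finset.sum_insert hj, Finset.sum_insert hj, ih,
      S.norm_eq j (x - ∑ i ∈ s, S.coord i x • S.vec i), map_sub, S.coord_sum]
    simp only [hj, if_false, sub_zero]
    rw [sub_sub, add_comm (∑ i ∈ s, S.coord i x • S.vec i)]
    ring

lemma sum_abs_coord_le (s : Finset ι) (x : V) : ∑ i ∈ s, |S.coord i x| ≤ ‖x‖ := by
  rw [S.norm_eq_sum s x]
  linarith [norm_nonneg (x - ∑ i ∈ s, S.coord i x • S.vec i)]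

lemma summable_abs_coord (x : V) : Summable fun i => |S.coord i x| :=
  summable_of_sum_le (fun _ => abs_nonneg _) fun s => S.sum_abs_coord_le s x

lemma norm_add_sum (s : Finset ι) (x : V) (c : ι → ℝ) :
    ‖x + ∑ i ∈ s, c i • S.vec i‖ =
      ∑ i ∈ s, |S.coord i x + c i| + ‖x - ∑ i ∈ s, S.coord i x • S.vec i‖ := by
  classical
  have h : ∀ i ∈ s, S.coord i (x + ∑ i ∈ s, c i • S.vec i) = S.coord i x + c i := fun i hi => by
    rw [map_add, S.coord_sum, if_pos hi]
  have h1 : ∑ i ∈ s, S.coord i (x + ∑ i ∈ s, c i • S.vec i) • S.vec i =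
      ∑ i ∈ s, S.coord i x • S.vec i + ∑ i ∈ s, c i • S.vec i := by
    rw [← Finset.sum_add_distrib]
    exact Finset.sum_congr rfl fun i hi => by rw [h i hi, add_smul]
  rw [S.norm_eq_sum s (x + ∑ i ∈ s, c i • S.vec i), h1, add_sub_add_right_eq_sub,
    Finset.sum_congr rfl fun i hi => by rw [h i hi]]

/-- Norm additivity forces coordinates of the same sign. -/
lemma coord_mul_nonneg {x y : V} (h : ‖x + y‖ = ‖x‖ + ‖y‖) (i : ι) :
    0 ≤ S.coord i x * S.coord i y := by
  have h1 := S.norm_eq i (x + y)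
  have h2 := S.norm_eq i x
  have h3 := S.norm_eq i y
  rw [map_add, add_smul, add_sub_add_comm] at h1
  have h4 := norm_add_le (x - S.coord i x • S.vec i) (y - S.coord i y • S.vec i)
  -- The remainders obey the triangle inequality, so additivity of the whole norm forces additivity
  -- of the coordinate parts.
  have h5 : |S.coord i x| + |S.coord i y| ≤ |S.coord i x + S.coord i y| := by linarith
  by_contra! hn
  rcases mul_neg_iff.1 hn with ⟨ha, hb⟩ | ⟨ha, hb⟩
  · rw [abs_of_pos ha, abs_of_neg hb] at h5
    rcases abs_cases (S.coord i x + S.coord i y) with h | h <;> linarith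
  · rw [abs_of_neg ha, abs_of_pos hb] at h5
    rcases abs_cases (S.coord i x + S.coord i y) with h | h <;> linarith

/-- Change of signs in an `LSystem`. -/
def changeSigns (σ : ι → ℝ) (hσ : ∀ i, |σ i| = 1) : LSystem ι V where
  vec i := σ i • S.vec i
  coord i := σ i • S.coord i
  coord_self i := by
    have : σ i * σ i = 1 := by rw [← abs_mul_abs_self, hσ]; norm_num
    simp [S.coord_self, this]
  coord_ne i j h := by simp [S.coord_ne i j h]
  norm_eq i x := by
    have : σ i * σ i = 1 := by rw [← abs_mul_abs_self, hσ]; norm_num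
    have h2 : (σ i * S.coord i x) * σ i = S.coord i x := by linear_combination S.coord i x * this
    simp only [LinearMap.smul_apply, smul_eq_mul, smul_smul, h2, abs_mul, hσ, one_mul]
    exact S.norm_eq i x

/-- `L`-atoms that are extreme points, no two of them antipodal, form an `LSystem`. -/
noncomputable def ofSet (G : Set V)
    (hG : G ⊆ Set.extremePoints ℝ (Metric.closedBall (0 : V) 1))
    (hat : ∀ e ∈ G, IsLAtom e) (hneg : ∀ e ∈ G, -e ∉ G) : LSystem G V where
  vec e := e
  coord e := (hat e e.2).choose
  coord_self e := (hat e e.2).choose_spec.1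
  norm_eq e := (hat e e.2).choose_spec.2
  coord_ne := by
    rintro ⟨e, he⟩ ⟨f, hf⟩ hef
    obtain ⟨h1, h2⟩ := (hat e he).choose_spec
    set φ := (hat e he).choose
    change φ f = 0
    by_contra h0
    have hne : e ≠ f := fun h => hef (Subtype.ext h)
    have hf1 : ‖f‖ ≤ 1 := by simpa using (hG hf).1
    have hn : ‖e‖ = 1 := by rw [h2 e, h1]; simp
    have hfe := h2 f
    set r := f - φ f • e with hr
    have hf' : f = φ f • e + r := by rw [hr]; abel
    -- With s the sign of `φ f`, the splitting f = |φ f| (s e) + r exhibits f as a convex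
    -- combination of unit-ball points; extremality then forces f = s e, which is e or -e.
    have hs : ∃ s : ℝ, |s| = 1 ∧ φ f = |φ f| * s := by
      rcases lt_or_gt_of_ne h0 with h | h
      · exact ⟨-1, by simp, by rw [abs_of_neg h]; ring⟩
      · exact ⟨1, by simp, by rw [abs_of_pos h]; ring⟩
    obtain ⟨s, hs1, hs2⟩ := hs
    have hnotse : s • e ≠ f := by
      intro h
      rcases abs_eq (zero_le_one) |>.1 hs1 with rfl | rfl
      · exact hne (by simpa using h)
      · exact hneg e he (by rw [← h, neg_one_smul] at hf; exact hf)
    have hpos : 0 < |φ f| := abs_pos.2 h0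
    by_cases hr0 : ‖r‖ = 0
    · have hr00 : r = 0 := norm_eq_zero.1 hr0
      have hle : |φ f| ≤ 1 := by linarith
      -- `f` is a multiple of `e`, hence an interior point of a segment unless it is `± e`
      rcases hle.lt_or_eq with hlt | heq
      · have h5 := (hG hf).2 (x₁ := s • e) (by simp [norm_smul, hs1, hn]) (x₂ := 0) (by simp)
          ⟨|φ f|, 1 - |φ f|, hpos, by linarith, by ring, by
            rw [smul_zero, add_zero, smul_smul, ← hs2]
            rw [hr00, add_zero] at hf'; exact hf'.symm⟩
        exact hnotse h5
      · apply hnotse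
        rw [hr00, add_zero] at hf'
        rw [heq, one_mul] at hs2
        rw [← hs2]; exact hf'.symm
    · have hrpos : 0 < ‖r‖ := lt_of_le_of_ne (norm_nonneg _) (Ne.symm hr0)
      have hfn : ‖f‖ = 1 := by
        by_contra hh
        have hlt : ‖f‖ < 1 := lt_of_le_of_ne hf1 hh
        have hfpos : 0 < ‖f‖ := by linarith
        have h5 := (hG hf).2 (x₁ := ‖f‖⁻¹ • f) (by simp [norm_smul, hfpos.ne']) (x₂ := 0)
          (by simp) ⟨‖f‖, 1 - ‖f‖, hfpos, by linarith, by ring, by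
            rw [smul_zero, add_zero, smul_smul, mul_inv_cancel₀ hfpos.ne', one_smul]⟩
        have h6 := congrArg norm h5
        rw [norm_smul, norm_inv, norm_norm, inv_mul_cancel₀ hfpos.ne'] at h6
        exact hh h6.symm
      have h5 := (hG hf).2 (x₁ := s • e) (by simp [norm_smul, hs1, hn]) (x₂ := ‖r‖⁻¹ • r)
          (by simp [norm_smul, hrpos.ne'])
          ⟨|φ f|, ‖r‖, hpos, hrpos, by rw [← hfe, hfn], by
            rw [smul_smul, smul_smul, ← hs2, mul_inv_cancel₀ hr0, one_smul]
            exact hf'.symm⟩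
      exact hnotse h5

end LSystem

/-! ### Extreme points of the unit ball of L₁(μ) -/

/-- The extreme points of the unit ball of `L₁(μ)` span `L`-summands. -/
lemma isLAtom_of_mem_extremePoints_Lp {Ω : Type*} [MeasurableSpace Ω] {μ : Measure Ω}
    {e : Lp ℝ 1 μ} (he : e ∈ Set.extremePoints ℝ (Metric.closedBall (0 : Lp ℝ 1 μ) 1))
    (he0 : e ≠ 0) : IsLAtom e := by
  have hint : ∀ f : Lp ℝ 1 μ, Integrable f μ := fun f => L1.integrable_coeFn f
  have hpos : 0 < ‖e‖ := norm_pos_iff.2 he0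
  have hle : ‖e‖ ≤ 1 := by simpa using he.1
  have hn : ‖e‖ = 1 := by
    by_contra hh
    have hlt : ‖e‖ < 1 := lt_of_le_of_ne hle hh
    have h5 := he.2 (x₁ := ‖e‖⁻¹ • e) (by simp [norm_smul, hpos.ne']) (x₂ := 0)
      (by simp) ⟨‖e‖, 1 - ‖e‖, hpos, by linarith, by ring, by
        rw [smul_zero, add_zero, smul_smul, mul_inv_cancel₀ hpos.ne', one_smul]⟩
    have h6 := congrArg norm h5
    rw [norm_smul, norm_inv, norm_norm, inv_mul_cancel₀ hpos.ne'] at h6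
    exact hh h6.symm
  have hsm : StronglyMeasurable (e : Ω → ℝ) := Lp.stronglyMeasurable e
  have hm : Measurable (e : Ω → ℝ) := hsm.measurable
  -- the measure with density `|e|` takes only the values `0` and `1`
  have dich : ∀ A : Set Ω, MeasurableSet A →
      (∀ᵐ x ∂μ, x ∈ A → e x = 0) ∨ (∀ᵐ x ∂μ, x ∉ A → e x = 0) := by
    intro A hA
    have hiA := (hint e).indicator hA
    have hiB := (hint e).indicator hA.compl
    set a : Lp ℝ 1 μ := hiA.toL1 _ with ha
    set b : Lp ℝ 1 μ := hiB.toL1 _ with hb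
    have ha' : a =ᵐ[μ] A.indicator e := hiA.coeFn_toL1
    have hb' : b =ᵐ[μ] Aᶜ.indicator e := hiB.coeFn_toL1
    have hab : a + b = e := by
      apply Lp.ext
      filter_upwards [Lp.coeFn_add a b, ha', hb'] with x h1 h2 h3
      rw [h1, Pi.add_apply, h2, h3]
      by_cases hx : x ∈ A <;> simp [hx]
    have hnorm : ‖a‖ + ‖b‖ = 1 := by
      rw [← hn, L1.norm_eq_integral_norm, L1.norm_eq_integral_norm, L1.norm_eq_integral_norm,
        ← integral_add (hint a).norm (hint b).norm]
      apply integral_congr_ae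
      filter_upwards [ha', hb'] with x h2 h3
      simp only [h2, h3]
      by_cases hx : x ∈ A <;> simp [hx]
    by_cases ha0 : a = 0
    · left
      have : a =ᵐ[μ] 0 := by rw [ha0]; exact Lp.coeFn_zero _ _ _
      filter_upwards [ha', this] with x h1 h2 hx
      rw [h1] at h2
      simpa [hx] using h2
    by_cases hb0 : b = 0
    · right
      have : b =ᵐ[μ] 0 := by rw [hb0]; exact Lp.coeFn_zero _ _ _
      filter_upwards [hb', this] with x h1 h2 hx
      rw [h1] at h2
      simpa [hx] using h2
    right
    have hap := norm_pos_iff.2 ha0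
    have hbp := norm_pos_iff.2 hb0
    have h5 := he.2 (x₁ := ‖a‖⁻¹ • a) (by simp [norm_smul, hap.ne']) (x₂ := ‖b‖⁻¹ • b)
      (by simp [norm_smul, hbp.ne']) ⟨‖a‖, ‖b‖, hap, hbp, hnorm, by
        rw [smul_smul, smul_smul, mul_inv_cancel₀ hap.ne', mul_inv_cancel₀ hbp.ne', one_smul,
          one_smul, hab]⟩
    have h6 := Lp.coeFn_smul (‖a‖⁻¹) a
    rw [h5] at h6
    filter_upwards [h6, ha'] with x h1 h2 hx
    rw [h1, Pi.smul_apply, h2]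
    simp [hx]
  set N : Set Ω := {x | e x ≠ 0} with hN
  have hNm : MeasurableSet N := hm (measurableSet_singleton 0).compl
  -- By the dichotomy, each level set of `f / e` is null or conull in the support of e, so this
  -- quotient is a.e. constant there.
  have hquot : ∀ f : Lp ℝ 1 μ, ∃ c : ℝ, ∀ᵐ x ∂μ, e x ≠ 0 → f x = c * e x := by
    intro f
    have hf : Measurable (f : Ω → ℝ) := (Lp.stronglyMeasurable f).measurable
    obtain ⟨c, hc⟩ := Filter.exists_eventuallyEq_const_of_forall_separating
      (l := ae (μ.restrict N)) (f := fun x => f x / e x) MeasurableSet (fun U hU => by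
        rcases dich _ ((hf.div hm) hU) with h | h
        · right
          rw [ae_restrict_iff' hNm]
          filter_upwards [h] with x hx hxN hxU
          exact hxN (hx hxU)
        · left
          rw [ae_restrict_iff' hNm]
          filter_upwards [h] with x hx hxN
          by_contra hxU
          exact hxN (hx hxU))
    refine ⟨c, ?_⟩
    rw [Filter.EventuallyEq, ae_restrict_iff' hNm] at hc
    filter_upwards [hc] with x hx hxN
    have := hx hxN
    simp only [Function.const_apply] at this
    rw [← this, div_mul_cancel₀ _ hxN]
  set σ : Ω → ℝ := fun x => SignType.sign (e x) with hσ
  have hσm : Measurable σ := by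
    have : σ = fun x => if 0 < e x then 1 else if e x < 0 then -1 else 0 := by
      funext x
      simp only [hσ, sign_apply]
      split_ifs <;> simp
    rw [this]
    exact Measurable.ite (hm measurableSet_Ioi) measurable_const
      (Measurable.ite (hm measurableSet_Iio) measurable_const measurable_const)
  have hσb : ∀ x, ‖σ x‖ ≤ 1 := fun x => by
    rcases lt_trichotomy (e x) 0 with h | h | h <;> simp [hσ, h]
  have hσe : ∀ x, σ x * e x = |e x| := fun x => by
    simp only [hσ]; exact sign_mul_self (e x)
  have hσi : ∀ f : Lp ℝ 1 μ, Integrable (fun x => σ x * f x) μ := fun f =>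
    (hint f).bdd_mul hσm.aestronglyMeasurable (Filter.Eventually.of_forall hσb)
  have hone : ∫ x, |e x| ∂μ = 1 := by
    rw [← hn, L1.norm_eq_integral_norm]; rfl
  -- Integration against the sign of e ignores everything off the support of e and returns the
  -- constant ratio c on it.
  refine ⟨{ toFun := fun f => ∫ x, σ x * f x ∂μ, map_add' := ?_, map_smul' := ?_ }, ?_, ?_⟩
  · intro f g
    rw [← integral_add (hσi f) (hσi g)]
    apply integral_congr_ae
    filter_upwards [Lp.coeFn_add f g] with x hx
    rw [hx, Pi.add_apply, mul_add]
  · intro c f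
    rw [RingHom.id_apply, smul_eq_mul, ← integral_const_mul]
    apply integral_congr_ae
    filter_upwards [Lp.coeFn_smul c f] with x hx
    rw [hx, Pi.smul_apply, smul_eq_mul]; ring
  · simp only [LinearMap.coe_mk, AddHom.coe_mk]
    simp_rw [hσe]; exact hone
  · intro f
    simp only [LinearMap.coe_mk, AddHom.coe_mk]
    obtain ⟨c, hc⟩ := hquot f
    have hφ : ∫ x, σ x * f x ∂μ = c := by
      calc ∫ x, σ x * f x ∂μ = ∫ x, c * |e x| ∂μ := by
            apply integral_congr_ae
            filter_upwards [hc] with x hx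
            by_cases h0 : e x = 0
            · simp [hσ, h0]
            · rw [hx h0, ← hσe]; ring
        _ = c := by rw [integral_const_mul, hone, mul_one]
    rw [hφ, L1.norm_eq_integral_norm, L1.norm_eq_integral_norm]
    have h1 : |c| = ∫ x, |c| * |e x| ∂μ := by rw [integral_const_mul, hone, mul_one]
    rw [h1, ← integral_add ((hint e).abs.const_mul _) (hint _).norm]
    apply integral_congr_ae
    filter_upwards [hc, Lp.coeFn_sub f (c • e), Lp.coeFn_smul c e] with x hx h2 h3
    rw [h2, Pi.sub_apply, h3, Pi.smul_apply, smul_eq_mul]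
    by_cases h0 : e x = 0
    · simp [h0]
    · rw [hx h0, sub_self, norm_zero, add_zero, Real.norm_eq_abs, abs_mul]

lemma IsLAtom.map {V W : Type*} [NormedAddCommGroup V] [NormedSpace ℝ V] [NormedAddCommGroup W]
    [NormedSpace ℝ W] (L : V ≃ₗᵢ[ℝ] W) {e : V} (h : IsLAtom (L e)) : IsLAtom e := by
  obtain ⟨φ, h1, h2⟩ := h
  refine ⟨φ ∘ₗ L.toLinearEquiv.toLinearMap, h1, fun x => ?_⟩
  rw [← L.norm_map x, h2 (L x), ← L.norm_map (x - _)]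
  simp

/-- In the dual of a Lindenstrauss space, the nonzero extreme points of the unit ball span
`L`-summands. -/
lemma IsLindenstraussSpace.isLAtom {X : Type u} [NormedAddCommGroup X] [NormedSpace ℝ X]
    (hX : IsLindenstraussSpace.{u, v} X) {e : StrongDual ℝ X}
    (he : e ∈ Set.extremePoints ℝ (Metric.closedBall (0 : StrongDual ℝ X) 1)) (he0 : e ≠ 0) :
    IsLAtom e := by
  obtain ⟨Ω, _, μ, ⟨L⟩⟩ := hX
  apply IsLAtom.map L
  apply isLAtom_of_mem_extremePoints_Lp
  · have h := image_extremePoints (𝕜 := ℝ) L (Metric.closedBall (0 : StrongDual ℝ X) 1)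
    rw [L.image_closedBall, map_zero] at h
    rw [← h]
    exact Set.mem_image_of_mem _ he
  · simpa using he0

/-! ### Weak-star closures -/

section WeakStar

variable {X : Type u} [NormedAddCommGroup X] [NormedSpace ℝ X]

lemma isClosed_weakStarClosure (A : Set (StrongDual ℝ X)) : IsClosed (weakStarClosure A) := by
  have h1 : Continuous (StrongDual.toWeakDual : StrongDual ℝ X → WeakDual ℝ X) :=
    NormedSpace.Dual.toWeakDual_continuous
  unfold weakStarClosure
  refine IsClosed.preimage h1 ?_
  exact isClosed_closure

lemma subset_weakStarClosure (A : Set (StrongDual ℝ X)) : A ⊆ weakStarClosure A := by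
  intro x hx
  have h : StrongDual.toWeakDual x ∈ StrongDual.toWeakDual '' A := Set.mem_image_of_mem _ hx
  exact subset_closure (X := WeakDual ℝ X) h

lemma Convex.weakStarClosure {A : Set (StrongDual ℝ X)} (hA : Convex ℝ A) :
    Convex ℝ (weakStarClosure A) := by
  have h1 : Convex ℝ (StrongDual.toWeakDual '' A) :=
    hA.linear_image (StrongDual.toWeakDual (𝕜 := ℝ) (E := X)).toLinearMap
  exact h1.closure.linear_preimage (StrongDual.toWeakDual (𝕜 := ℝ) (E := X)).toLinearMap

lemma isWeakStarCompact_weakStarClosure {A : Set (StrongDual ℝ X)}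
    (h : weakStarClosure A ⊆ Metric.closedBall 0 1) : IsWeakStarCompact (weakStarClosure A) := by
  have h1 : StrongDual.toWeakDual '' weakStarClosure A = closure (StrongDual.toWeakDual '' A) :=
    Set.image_preimage_eq _ (StrongDual.toWeakDual (𝕜 := ℝ) (E := X)).surjective
  rw [IsWeakStarCompact, h1]
  refine IsCompact.of_isClosed_subset (WeakDual.isCompact_closedBall 0 1) isClosed_closure ?_
  intro y hy
  exact h (a := WeakDual.toStrongDual y) hy

lemma continuous_weakDual_eval (f : X) : Continuous fun y : WeakDual ℝ X => y f :=
  WeakDual.eval_continuous f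

/-- The half-space cut out by f is convex and weak-star closed. Since the norm is only weak-star
lower semicontinuous, a lower bound on norms has to pass to the closure through a common f like
this. -/
lemma le_apply_of_mem_weakStarClosure {A : Set (StrongDual ℝ X)} {f : X} {a : ℝ}
    (h : ∀ e ∈ A, a ≤ e f) {y : StrongDual ℝ X} (hy : y ∈ weakStarClosure (convexHull ℝ A)) :
    a ≤ y f := by
  have h1 : convexHull ℝ A ⊆ {e | a ≤ e f} := by
    apply convexHull_min h
    intro x hx y hy s t hs ht hst
    have hx' : a ≤ x f := hx
    have hy' : a ≤ y f := hy
    change a ≤ s * x f + t * y f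
    calc a = s * a + t * a := by rw [← add_mul, hst, one_mul]
      _ ≤ _ := by gcongr
  have h2 : closure (StrongDual.toWeakDual '' convexHull ℝ A) ⊆ {e : WeakDual ℝ X | a ≤ e f} := by
    apply closure_minimal
    · rintro _ ⟨e, he, rfl⟩
      exact h1 he
    · exact isClosed_le continuous_const (continuous_weakDual_eval f)
  exact h2 hy

lemma norm_le_of_mem_weakStarClosure {A : Set (StrongDual ℝ X)} (h : ∀ e ∈ A, ‖e‖ ≤ 1)
    {y : StrongDual ℝ X} (hy : y ∈ weakStarClosure (convexHull ℝ A)) : ‖y‖ ≤ 1 := by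
  refine y.opNorm_le_bound zero_le_one fun f => ?_
  have h1 : ∀ e ∈ A, |e f| ≤ ‖f‖ := fun e he => by
    have := e.le_opNorm f
    rw [Real.norm_eq_abs] at this
    nlinarith [h e he, norm_nonneg f]
  have h2 : -‖f‖ ≤ y f :=
    le_apply_of_mem_weakStarClosure (fun e he => (abs_le.1 (h1 e he)).1) hy
  have h3 : -‖f‖ ≤ y (-f) :=
    le_apply_of_mem_weakStarClosure
      (fun e he => by rw [map_neg]; linarith [(abs_le.1 (h1 e he)).2]) hy
  rw [map_neg] at h3
  rw [Real.norm_eq_abs, one_mul]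
  exact abs_le.2 ⟨h2, by linarith⟩

end WeakStar

/-! ### A fixed-point-free shift on a convex subset of the sphere -/

/-- A norm closed convex subset of the unit sphere containing all vectors of an infinite `LSystem`
fails the fixed point property. -/
lemma LSystem.not_hasFPP {V : Type*} [NormedAddCommGroup V] [NormedSpace ℝ V] [CompleteSpace V]
    (S : LSystem ℕ V) {K : Set V} (hK : Convex ℝ K) (hcl : IsClosed K)
    (hsph : K ⊆ Metric.sphere 0 1) (hvec : ∀ n, S.vec n ∈ K) : ¬ HasFPP K := by
  have hn : ∀ x ∈ K, ‖x‖ = 1 := fun x hx => by simpa using hsph hx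
  have hnonneg : ∀ x ∈ K, ∀ n, 0 ≤ S.coord n x := by
    intro x hx n
    have h1 := hn _ (hK hx (hvec n) (a := 1/2) (b := 1/2) (by norm_num) (by norm_num)
      (by norm_num))
    rw [← smul_add, norm_smul] at h1
    have h2 : ‖x + S.vec n‖ = ‖x‖ + ‖S.vec n‖ := by
      rw [hn x hx, hn _ (hvec n)]
      norm_num at h1
      linarith
    simpa [S.coord_self] using S.coord_mul_nonneg h2 n
  -- The mass missing from the first N coordinates equals the norm of the remainder; this is what
  -- makes the shift nonexpansive.
  have hrest : ∀ x ∈ K, ∀ N, 1 - ∑ n ∈ Finset.range N, S.coord n x =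
      ‖x - ∑ n ∈ Finset.range N, S.coord n x • S.vec n‖ := by
    intro x hx N
    have h1 := S.norm_eq_sum (Finset.range N) x
    rw [hn x hx, Finset.sum_congr rfl fun n _ => abs_of_nonneg (hnonneg x hx n)] at h1
    linarith
  -- `P N x` is a finite convex combination of the vectors for x in K, so its norm limit `T x` stays
  -- in K.
  set P : ℕ → V → V := fun N x => ∑ n ∈ Finset.range N, S.coord n x • S.vec (n + 1) +
    (1 - ∑ n ∈ Finset.range N, S.coord n x) • S.vec 0 with hP
  have hsum : ∀ x, Summable fun n => S.coord n x := fun x => (S.summable_abs_coord x).of_abs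
  have hsumv : ∀ x, Summable fun n => S.coord n x • S.vec (n + 1) := fun x =>
    Summable.of_norm (by simpa [norm_smul, S.norm_vec] using S.summable_abs_coord x)
  set T : V → V := fun x => ∑' n, S.coord n x • S.vec (n + 1) +
    (1 - ∑' n, S.coord n x) • S.vec 0 with hT
  have hlim : ∀ x, Tendsto (fun N => P N x) atTop (𝓝 (T x)) := fun x =>
    (hsumv x).hasSum.tendsto_sum_nat.add
      ((tendsto_const_nhds.sub (hsum x).hasSum.tendsto_sum_nat).smul_const _)
  have hTK : ∀ x ∈ K, T x ∈ K := by
    intro x hx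
    refine hcl.mem_of_tendsto (hlim x) (Eventually.of_forall fun N => ?_)
    have h0 : 0 ≤ 1 - ∑ n ∈ Finset.range N, S.coord n x := by
      rw [hrest x hx]; exact norm_nonneg _
    have := hK.sum_mem (t := Finset.range (N + 1))
      (w := fun k => if k = 0 then 1 - ∑ n ∈ Finset.range N, S.coord n x else S.coord (k - 1) x)
      (z := S.vec) (fun k _ => by
        split_ifs
        · exact h0
        · exact hnonneg x hx _)
      (by rw [Finset.sum_range_succ']; simp) (fun k _ => hvec k)
    rw [Finset.sum_range_succ'] at this
    simpa [hP] using this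
  have hTn : ∀ x ∈ K, ∀ y ∈ K, ‖T x - T y‖ ≤ ‖x - y‖ := by
    intro x hx y hy
    refine le_of_tendsto ((hlim x).sub (hlim y)).norm (Eventually.of_forall fun N => ?_)
    have h1 : P N x - P N y = ∑ n ∈ Finset.range N, S.coord n (x - y) • S.vec (n + 1) +
        ((1 - ∑ n ∈ Finset.range N, S.coord n x) -
          (1 - ∑ n ∈ Finset.range N, S.coord n y)) • S.vec 0 := by
      simp only [hP, map_sub, sub_smul, Finset.sum_sub_distrib]
      abel
    rw [h1, S.norm_eq_sum (Finset.range N) (x - y), hrest x hx, hrest y hy]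
    refine (norm_add_le _ _).trans (add_le_add ?_ ?_)
    · refine (norm_sum_le _ _).trans (le_of_eq ?_)
      simp [norm_smul, S.norm_vec]
    · rw [norm_smul, S.norm_vec, mul_one, Real.norm_eq_abs]
      refine (abs_norm_sub_norm_le _ _).trans (le_of_eq ?_)
      congr 1
      simp only [map_sub, sub_smul, Finset.sum_sub_distrib]
      abel
  intro hF
  obtain ⟨⟨x, hx⟩, hfix⟩ := hF (fun x => ⟨T x, hTK x x.2⟩) fun x y => hTn x x.2 y y.2
  have hfix : T x = x := congrArg Subtype.val hfix
  have hc : ∀ j, Tendsto (fun N => S.coord j (P N x)) atTop (𝓝 (S.coord j x)) := fun j => by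
    have := ((S.continuous_coord j).tendsto _).comp (hlim x)
    rw [hfix] at this
    exact this
  -- A fixed point has constant coordinates, which vanish by summability; all its mass then goes to
  -- the vector with index 0, whose coordinate would be 1.
  have hsucc : ∀ j, S.coord (j + 1) x = S.coord j x := by
    intro j
    refine tendsto_nhds_unique (hc (j + 1)) ?_
    refine tendsto_const_nhds.congr' ?_
    filter_upwards [eventually_gt_atTop j] with N hN
    simp only [hP, map_add, map_smul, map_sum, smul_eq_mul]
    rw [Finset.sum_eq_single_of_mem j (Finset.mem_range.2 hN), S.coord_self,
      S.coord_ne (j + 1) 0 (by simp)]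
    · simp
    · intro k _ hk
      rw [S.coord_ne _ _ (by simpa using hk.symm), mul_zero]
  have hconst : ∀ j, S.coord j x = S.coord 0 x := fun j => by
    induction j with
    | zero => rfl
    | succ j ih => rw [hsucc, ih]
  have hzero : S.coord 0 x = 0 := by
    have h1 := (hsum x).tendsto_atTop_zero
    simp_rw [hconst] at h1
    exact tendsto_nhds_unique tendsto_const_nhds h1
  have hone : S.coord 0 x = 1 := by
    refine tendsto_nhds_unique (hc 0) ?_
    refine tendsto_const_nhds.congr fun N => ?_
    simp only [hP, map_add, map_smul, map_sum, smul_eq_mul]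
    rw [Finset.sum_eq_zero, Finset.sum_eq_zero, S.coord_self]
    · simp
    · intro k _; rw [hconst, hzero]
    · intro k _; rw [hconst, hzero, zero_mul]
  rw [hzero] at hone
  exact zero_ne_one hone

/-- Restriction of an `LSystem` along an injection. -/
def LSystem.comap {ι κ V : Type*} [NormedAddCommGroup V] [NormedSpace ℝ V] (S : LSystem ι V)
    (g : κ ↪ ι) : LSystem κ V where
  vec k := S.vec (g k)
  coord k := S.coord (g k)
  coord_self _ := S.coord_self _
  coord_ne _ _ h := S.coord_ne _ _ fun h' => h (g.injective h')
  norm_eq k := S.norm_eq (g k)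

/-- The sphere condition keeps 0 out of the closed hull. Hence C has no antipodal pair, whose
midpoint would be 0, and its points form an L-system. -/
lemma not_hasWeakStarFPP_of_infinite {X : Type u} [NormedAddCommGroup X] [NormedSpace ℝ X]
    (hat : ∀ e ∈ Set.extremePoints ℝ (Metric.closedBall (0 : StrongDual ℝ X) 1), e ≠ 0 →
      IsLAtom e)
    {C : Set (StrongDual ℝ X)} (hinf : C.Infinite)
    (hC : C ⊆ Set.extremePoints ℝ (Metric.closedBall (0 : StrongDual ℝ X) 1))
    (hS : weakStarClosure (convexHull ℝ C) ⊆ Metric.sphere (0 : StrongDual ℝ X) 1) :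
    ¬ HasWeakStarFPP X := by
  intro hF
  have hconv : Convex ℝ (convexHull ℝ C) := convex_convexHull ℝ C
  have hCK : C ⊆ weakStarClosure (convexHull ℝ C) :=
    (subset_convexHull ℝ C).trans (subset_weakStarClosure _)
  have h0 : (0 : StrongDual ℝ X) ∉ weakStarClosure (convexHull ℝ C) := fun h => by
    simpa using hS h
  set S₀ := LSystem.ofSet C hC (fun e he => hat e (hC he) fun h => h0 (h ▸ hCK he))
    (fun e he hne => h0 (by
      have := hconv.weakStarClosure (hCK he) (hCK hne) (a := 1/2) (b := 1/2) (by norm_num)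
        (by norm_num) (by norm_num)
      simpa using this))
  refine (S₀.comap (hinf.natEmbedding C)).not_hasFPP hconv.weakStarClosure
    (isClosed_weakStarClosure _) hS (fun n => hCK (hinf.natEmbedding C n).2)
    (hF _ (hinf.nonempty.mono hCK) hconv.weakStarClosure
      (isWeakStarCompact_weakStarClosure (hS.trans Metric.sphere_subset_closedBall)))

/-! ### Extracting a sequence whose closed hull lies in the sphere -/

section Norming

variable {X : Type u} [NormedAddCommGroup X] [NormedSpace ℝ X]

lemma exists_lt_apply_of_lt_norm (w : StrongDual ℝ X) {r : ℝ} (hr : r < ‖w‖) :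
    ∃ f : X, ‖f‖ ≤ 1 ∧ r < w f := by
  obtain ⟨f, hf, h⟩ := w.exists_lt_apply_of_lt_opNorm hr
  rw [Real.norm_eq_abs] at h
  rcases lt_abs.1 h with h | h
  · exact ⟨f, hf.le, h⟩
  · exact ⟨-f, by simpa using hf.le, by simpa using h⟩

lemma apply_le_one {w : StrongDual ℝ X} {f : X} (hw : ‖w‖ ≤ 1) (hf : ‖f‖ ≤ 1) : w f ≤ 1 := by
  have h := (le_abs_self (w f)).trans (w.le_opNorm f)
  nlinarith [norm_nonneg f, norm_nonneg w]

/-- If the norm of a sum of functionals is maximal, they are almost normed simultaneously. -/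
lemma exists_almost_norming {ι : Type*} (s : Finset ι) {v : StrongDual ℝ X}
    {w : ι → StrongDual ℝ X} (hv : ‖v‖ ≤ 1) (hw : ∀ i, ‖w i‖ ≤ 1)
    (h : ‖v + ∑ i ∈ s, w i‖ = 1 + s.card) {ε : ℝ} (hε : 0 < ε) :
    ∃ f : X, ‖f‖ ≤ 1 ∧ 1 - ε < v f ∧ ∀ i ∈ s, 1 - ε < w i f := by
  classical
  obtain ⟨f, hf, hlt⟩ := exists_lt_apply_of_lt_norm (v + ∑ i ∈ s, w i)
    (r := 1 + s.card - ε) (by linarith)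
  have hsum : (v + ∑ i ∈ s, w i) f = v f + ∑ i ∈ s, w i f := by
    simp
  rw [hsum] at hlt
  have hle : ∀ t : Finset ι, ∑ i ∈ t, w i f ≤ t.card := fun t => by
    simpa using Finset.sum_le_card_nsmul t (fun i => w i f) 1 fun i _ => apply_le_one (hw i) hf
  refine ⟨f, hf, by linarith [hle s], fun i hi => ?_⟩
  -- Each term is at most 1, so a total within ε of its maximum leaves every single term within ε of
  -- 1.
  rw [← Finset.add_sum_erase s _ hi] at hlt
  have h1 := hle (s.erase i)
  have h2 : ((s.erase i).card : ℝ) + 1 = s.card := by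
    exact_mod_cast Finset.card_erase_add_one hi
  linarith [apply_le_one hv hf]

/-- If a vector `v` of norm one with nonnegative coordinates is in the weak-star closed convex hull
of each cofinite part of an `LSystem`, then there are infinitely many vectors of the system whose
weak-star closed convex hull is contained in the unit sphere. -/
lemma LSystem.exists_infinite_subset {ι : Type*} (S : LSystem ι (StrongDual ℝ X))
    {v : StrongDual ℝ X} (hv1 : ‖v‖ = 1) (hv : ∀ i, 0 ≤ S.coord i v)
    (h : ∀ (s : Finset ι) (g : X) (t : ℝ), t < v g → ∃ i ∉ s, t < S.vec i g) :
    ∃ C : Set (StrongDual ℝ X), C.Infinite ∧ C ⊆ Set.range S.vec ∧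
      weakStarClosure (convexHull ℝ C) ⊆ Metric.sphere (0 : StrongDual ℝ X) 1 := by
  classical
  -- Nonnegative coordinates rule out cancellation, so v and any finite part of the system are
  -- almost normed by one f.
  have hnorm : ∀ s : Finset ι, ‖v + ∑ i ∈ s, S.vec i‖ = 1 + s.card := by
    intro s
    have h1 := S.norm_add_sum s v (fun _ => 1)
    have h2 := S.norm_eq_sum s v
    simp only [one_smul] at h1
    rw [h1]
    have h3 : ∑ i ∈ s, |S.coord i v + 1| = ∑ i ∈ s, |S.coord i v| + s.card := by
      rw [Finset.sum_congr rfl fun i _ => by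
        rw [abs_of_nonneg (by linarith [hv i]), ← abs_of_nonneg (hv i)], Finset.sum_add_distrib]
      simp
    rw [h3]; linarith
  have hvec : ∀ i, ‖S.vec i‖ ≤ 1 := fun i => (S.norm_vec i).le
  -- a state: the indices chosen so far and the potential `y ↦ c - y g`
  let St := {p : Finset ι × X × ℝ // p.2.2 - v p.2.1 < 1}
  have step : ∀ (n : ℕ) (p : St), ∃ (f : X) (i : ι) (q : St), ‖f‖ ≤ 1 ∧
      (∀ j ∈ p.1.1, 1 - (1 / 2) ^ n < S.vec j f) ∧ i ∉ p.1.1 ∧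
      q.1 = (insert i p.1.1, p.1.2.1 + (2 : ℝ) ^ n • f, p.1.2.2 + 2 ^ n) ∧
      q.1.2.2 - S.vec i q.1.2.1 < 1 := by
    rintro n ⟨⟨s, g, c⟩, hp⟩
    simp only at hp
    have h2 : (0 : ℝ) < 2 ^ n := by positivity
    -- The bound (1/2)^n makes f almost norm the indices already chosen; the other bound keeps the
    -- potential at v below 1 after adding 2^n (1 - v f).
    obtain ⟨ε, hε, hε1, hε2⟩ : ∃ ε : ℝ, 0 < ε ∧ ε ≤ (1 / 2) ^ n ∧ 2 ^ n * ε ≤ 1 - (c - v g) := by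
      refine ⟨min ((1 / 2) ^ n) ((1 - (c - v g)) / 2 ^ n), lt_min (by positivity)
        (div_pos (by linarith) h2), min_le_left _ _, ?_⟩
      rw [mul_comm, ← le_div_iff₀ h2]
      exact min_le_right _ _
    obtain ⟨f, hf, hfv, hfs⟩ := exists_almost_norming s hv1.le hvec (hnorm s) hε
    have hq : c + 2 ^ n - v (g + (2 : ℝ) ^ n • f) < 1 := by
      rw [map_add, map_smul, smul_eq_mul]
      nlinarith
    -- The potential is below 1 at v, hence also at some unused vector of the system.
    obtain ⟨i, his, hi⟩ := h s (g + (2 : ℝ) ^ n • f) (c + 2 ^ n - 1) (by linarith)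
    exact ⟨f, i, ⟨(insert i s, g + (2 : ℝ) ^ n • f, c + 2 ^ n), hq⟩, hf,
      fun j hj => by linarith [hfs j hj], his, rfl, by simp only; linarith⟩
  choose f i q hf hfs his hq hqi using step
  let P : ℕ → St := fun n => Nat.rec ⟨(∅, 0, 0), by simp⟩ (fun n p => q n p) n
  have hP : ∀ n, P (n + 1) = q n (P n) := fun n => rfl
  set F : ℕ → X := fun n => f n (P n) with hF
  set I : ℕ → ι := fun n => i n (P n) with hI
  have hPs : ∀ n, (P (n + 1)).1.1 = insert (I n) (P n).1.1 := fun n => by rw [hP, hq]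
  have hmem : ∀ n k, k < n → I k ∈ (P n).1.1 := by
    intro n
    induction n with
    | zero => intro k hk; omega
    | succ n ih =>
      intro k hk
      rw [hPs, Finset.mem_insert]
      rcases Nat.lt_succ_iff_lt_or_eq.1 hk with h | rfl
      · exact Or.inr (ih k h)
      · exact Or.inl rfl
  have hpot : ∀ (y : StrongDual ℝ X) n, (P n).1.2.2 - y (P n).1.2.1 =
      ∑ l ∈ Finset.range n, 2 ^ l * (1 - y (F l)) := by
    intro y n
    induction n with
    | zero => simp [P]
    | succ n ih =>
      rw [Finset.sum_range_succ, ← ih, hP, hq]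
      simp only [map_add, map_smul, smul_eq_mul, hF]
      ring
  -- Indices chosen before stage n are handled by the choice of `F n`. For later ones, the potential
  -- is a sum of nonnegative terms below 1, so its term 2^n (1 - y(F n)) is below 1.
  have hlarge : ∀ n k, 1 - (1 / 2) ^ n ≤ S.vec (I k) (F n) := by
    intro n k
    rcases lt_or_ge k n with hk | hk
    · exact (hfs n (P n) _ (hmem n k hk)).le
    · have h1 := (hpot (S.vec (I k)) (k + 1)).symm.trans_lt (hqi k (P k))
      have h2 := Finset.single_le_sum (f := fun l => (2 : ℝ) ^ l * (1 - S.vec (I k) (F l)))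
        (fun l _ => mul_nonneg (by positivity)
          (sub_nonneg.2 (apply_le_one (hvec (I k)) (hf l (P l)))))
        (Finset.mem_range.2 (Nat.lt_succ_of_le hk))
      have h3 : (2 : ℝ) ^ n * (1 / 2) ^ n = 1 := by rw [← mul_pow]; norm_num
      have h4 : (0 : ℝ) < 2 ^ n := by positivity
      nlinarith
  have hinj : Function.Injective I := by
    have : ∀ k n, k < n → I k ≠ I n := fun k n hk he => his n (P n) (by
      have := hmem n k hk; rw [he] at this; exact this)
    intro k n hkn
    rcases lt_trichotomy k n with hlt | rfl | hlt
    · exact absurd hkn (this k n hlt)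
    · rfl
    · exact absurd hkn.symm (this n k hlt)
  refine ⟨Set.range fun k => S.vec (I k), Set.infinite_range_of_injective
    (S.vec_injective.comp hinj), ?_, ?_⟩
  · rintro _ ⟨k, rfl⟩
    exact ⟨_, rfl⟩
  · intro y hy
    have hy1 : ‖y‖ ≤ 1 := norm_le_of_mem_weakStarClosure (by rintro _ ⟨k, rfl⟩; exact hvec _) hy
    have hy2 : ∀ n : ℕ, 1 - (1 / 2) ^ n ≤ ‖y‖ := fun n => by
      have h1 : 1 - (1 / 2) ^ n ≤ y (F n) :=
        le_apply_of_mem_weakStarClosure (by rintro _ ⟨k, rfl⟩; exact hlarge n k) hy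
      have h2 := (le_abs_self (y (F n))).trans (y.le_opNorm (F n))
      have h3 : ‖F n‖ ≤ 1 := hf n (P n)
      nlinarith [norm_nonneg y]
    have h3 : Tendsto (fun n : ℕ => 1 - (1 / 2 : ℝ) ^ n) atTop (𝓝 (1 - 0)) :=
      tendsto_const_nhds.sub (tendsto_pow_atTop_nhds_zero_of_lt_one (by norm_num) (by norm_num))
    have h4 := le_of_tendsto' h3 hy2
    rw [mem_sphere_zero_iff_norm]
    linarith

end Norming

/-! ### Uncountably many extreme points -/

section Accumulation

variable {X : Type u} [NormedAddCommGroup X] [NormedSpace ℝ X]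

/-- The dual ball of a separable space is weak-star compact and metrizable, hence second countable;
a subset without accumulation points of its own would be discrete, and so countable. -/
lemma exists_accPt_of_not_countable [TopologicalSpace.SeparableSpace X]
    {E : Set (StrongDual ℝ X)} (hE : E ⊆ Metric.closedBall 0 1) (hc : ¬ E.Countable) :
    ∃ v ∈ E, AccPt (StrongDual.toWeakDual v) (𝓟 (StrongDual.toWeakDual '' E)) := by
  set B : Set (WeakDual ℝ X) := WeakDual.toStrongDual ⁻¹' Metric.closedBall 0 1 with hB
  have hBc : IsCompact B := WeakDual.isCompact_closedBall 0 1
  have : TopologicalSpace.MetrizableSpace B := WeakDual.metrizable_of_isCompact ℝ X B hBc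
  have : CompactSpace B := isCompact_iff_compactSpace.1 hBc
  let _ := TopologicalSpace.metrizableSpaceMetric B
  have hB2 : SecondCountableTopology B := inferInstance
  set W : Set (WeakDual ℝ X) := StrongDual.toWeakDual '' E with hW
  have hWB : W ⊆ B := by
    rintro _ ⟨e, he, rfl⟩
    exact hE he
  by_contra! hno
  have hd : DiscreteTopology W := by
    rw [discreteTopology_subtype_iff]
    rintro _ ⟨e, he, rfl⟩
    exact not_neBot.1 (hno e he)
  have h2 : SecondCountableTopology W :=
    (IsEmbedding.inclusion hWB).secondCountableTopology
  have h3 : Countable W :=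
    TopologicalSpace.separableSpace_iff_countable.1 inferInstance
  apply hc
  have h4 : W.Countable := h3
  exact (Set.countable_of_injective_of_countable_image
    (StrongDual.toWeakDual (𝕜 := ℝ) (E := X)).injective.injOn h4)

lemma exists_infinite_of_not_countable [TopologicalSpace.SeparableSpace X]
    (hat : ∀ e ∈ Set.extremePoints ℝ (Metric.closedBall (0 : StrongDual ℝ X) 1), e ≠ 0 →
      IsLAtom e)
    (hc : ¬ (Set.extremePoints ℝ (Metric.closedBall (0 : StrongDual ℝ X) 1)).Countable) :
    ∃ C : Set (StrongDual ℝ X), C.Infinite ∧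
      C ⊆ Set.extremePoints ℝ (Metric.closedBall (0 : StrongDual ℝ X) 1) ∧
      weakStarClosure (convexHull ℝ C) ⊆ Metric.sphere (0 : StrongDual ℝ X) 1 := by
  classical
  set E := Set.extremePoints ℝ (Metric.closedBall (0 : StrongDual ℝ X) 1) with hE
  have hc' : ¬ (E \ {0}).Countable := fun h => hc (by
    refine (h.union (Set.countable_singleton 0)).mono fun x hx => ?_
    by_cases h0 : x = 0
    · exact Or.inr h0
    · exact Or.inl ⟨hx, h0⟩)
  obtain ⟨v, ⟨hvE, hv0⟩, hacc⟩ := exists_accPt_of_not_countable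
    (Set.sdiff_subset.trans extremePoints_subset) hc'
  have hv0 : v ≠ 0 := hv0
  obtain ⟨f, -, hf⟩ := exists_lt_apply_of_lt_norm v (norm_pos_iff.2 hv0)
  -- An open half-space around v excludes antipodal pairs while v still accumulates inside it.
  let G : Set (StrongDual ℝ X) := {e | e ∈ E ∧ 0 < e f}
  have hGE : G ⊆ E := fun e he => he.1
  have hG0 : ∀ e ∈ G, e ≠ 0 := by
    rintro e he rfl
    exact lt_irrefl _ he.2
  have hGn : ∀ e ∈ G, -e ∉ G := fun e he hne => by
    have h1 : 0 < (-e) f := hne.2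
    have h2 : 0 < e f := he.2
    rw [neg_apply] at h1
    linarith
  set S := LSystem.ofSet G hGE (fun e he => hat e (hGE he) (hG0 e he)) hGn with hS
  have hvG : v ∈ G := ⟨hvE, hf⟩
  obtain ⟨C, hC1, hC2, hC3⟩ := S.exists_infinite_subset (v := v) (S.norm_vec ⟨v, hvG⟩)
    (fun i => by
      by_cases hi : i = ⟨v, hvG⟩
      · have h1 := S.coord_self i
        rw [hi] at h1
        rw [hi]
        exact h1.symm ▸ zero_le_one
      · exact (S.coord_ne i ⟨v, hvG⟩ hi).ge)
    (fun s g t ht => by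
      have hfin : (StrongDual.toWeakDual '' ((Subtype.val '' (s : Set G)) \ {v})).Finite :=
        ((s.finite_toSet.image _).subset Set.sdiff_subset).image _
      have hU1 : (StrongDual.toWeakDual '' ((Subtype.val '' (s : Set G)) \ {v}))ᶜ ∈
          𝓝 (StrongDual.toWeakDual v) := by
        refine hfin.isClosed.isOpen_compl.mem_nhds ?_
        rintro ⟨w, hw, hwv⟩
        exact hw.2 (StrongDual.toWeakDual.injective hwv)
      have hU2 : {y : WeakDual ℝ X | t < y g} ∈ 𝓝 (StrongDual.toWeakDual v) :=
        (isOpen_lt continuous_const (continuous_weakDual_eval g)).mem_nhds ht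
      have hU3 : {y : WeakDual ℝ X | 0 < y f} ∈ 𝓝 (StrongDual.toWeakDual v) :=
        (isOpen_lt continuous_const (continuous_weakDual_eval f)).mem_nhds hf
      obtain ⟨_, ⟨hne, ⟨e, ⟨heE, -⟩, rfl⟩⟩, hes, heg, hef⟩ :=
        ((accPt_iff_frequently.1 hacc).and_eventually
          (inter_mem hU1 (inter_mem hU2 hU3))).exists
      refine ⟨⟨e, heE, hef⟩, fun hmem => hes ⟨e, ⟨⟨_, hmem, rfl⟩, fun hev => hne ?_⟩, rfl⟩, heg⟩
      rw [Set.mem_singleton_iff.1 hev])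
  refine ⟨C, hC1, hC2.trans ?_, hC3⟩
  rintro _ ⟨i, rfl⟩
  exact hGE i.2

end Accumulation

/-! ### Countably many extreme points span the dual -/

section Boundary

variable {X : Type u} [NormedAddCommGroup X] [NormedSpace ℝ X]

/-- Each vector attains its norm at an extreme point of the dual unit ball. -/
lemma exists_mem_extremePoints_apply_eq_norm (g : X) :
    ∃ e ∈ Set.extremePoints ℝ (Metric.closedBall (0 : StrongDual ℝ X) 1), e g = ‖g‖ := by
  set B : Set (WeakDual ℝ X) := WeakDual.toStrongDual ⁻¹' Metric.closedBall 0 1 with hB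
  have hBc : IsCompact B := WeakDual.isCompact_closedBall 0 1
  have hle : ∀ y ∈ B, y g ≤ ‖g‖ := fun y hy => by
    have h1 : ‖WeakDual.toStrongDual y‖ ≤ 1 := by
      have : WeakDual.toStrongDual y ∈ Metric.closedBall 0 1 := hy
      simpa using this
    have h2 := (le_abs_self _).trans ((WeakDual.toStrongDual y).le_opNorm g)
    rw [WeakDual.toStrongDual_apply] at h2
    nlinarith [norm_nonneg g]
  let l : WeakDual ℝ X →L[ℝ] ℝ :=
    { toFun := fun y => y g
      map_add' := fun _ _ => rfl
      map_smul' := fun _ _ => rfl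
      cont := continuous_weakDual_eval g }
  -- The functionals maximal at g form a compact exposed face, nonempty by Hahn–Banach; its extreme
  -- points, which exist, are extreme in the ball.
  have hexp : IsExposed ℝ B {y ∈ B | ∀ w ∈ B, l w ≤ l y} := fun _ => ⟨l, rfl⟩
  obtain ⟨e₀, he₀, he₁⟩ := exists_dual_vector'' ℝ g
  have he₁ : e₀ g = ‖g‖ := he₁
  have h₀ : StrongDual.toWeakDual e₀ ∈ B := by
    change e₀ ∈ Metric.closedBall 0 1
    simpa using he₀
  have hne : {y ∈ B | ∀ w ∈ B, l w ≤ l y}.Nonempty :=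
    ⟨StrongDual.toWeakDual e₀, h₀, fun w hw => (hle w hw).trans he₁.ge⟩
  have : LocallyConvexSpace ℝ (WeakDual ℝ X) :=
    (WeakDual.withSeminorms ℝ X).toLocallyConvexSpace
  obtain ⟨y, hy⟩ := (hexp.isCompact hBc).extremePoints_nonempty hne
  have hyB := hexp.isExtreme.extremePoints_subset_extremePoints hy
  refine ⟨WeakDual.toStrongDual y, ?_, ?_⟩
  · have h := image_extremePoints (𝕜 := ℝ) (WeakDual.toStrongDual (𝕜 := ℝ) (E := X)) B
    rw [hB, Set.image_preimage_eq _ (WeakDual.toStrongDual (𝕜 := ℝ) (E := X)).surjective] at h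
    rw [← h]
    exact Set.mem_image_of_mem _ hyB
  · exact le_antisymm (hle y hyB.1) (he₁.ge.trans (hy.1.2 _ h₀))

/-- If a countable `LSystem` of the dual norms all vectors, then no nonzero functional is
orthogonal to it. -/
lemma LSystem.eq_zero_of_coord_eq_zero [CompleteSpace X] {ι : Type*} [Countable ι]
    (S : LSystem ι (StrongDual ℝ X)) (hb : ∀ g : X, g ≠ 0 → ∃ i, |S.vec i g| = ‖g‖)
    {z : StrongDual ℝ X} (hz : ∀ i, S.coord i z = 0) : ‖z‖ ≠ 1 := by
  classical
  intro hz1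
  obtain ⟨enc, henc⟩ := exists_injective_nat ι
  have hvec : ∀ i, ‖S.vec i‖ ≤ 1 := fun i => (S.norm_vec i).le
  let C : ℕ → Set X := fun k => {g | ‖g‖ ≤ 1 ∧ 1 / 2 ≤ z g ∧ ∀ i, enc i < k → |S.vec i g| ≤ 1 / 8}
  have hCmono : ∀ j k, k ≤ j → C j ⊆ C k := fun j k hkj g hg =>
    ⟨hg.1, hg.2.1, fun i hi => hg.2.2 i (hi.trans_le hkj)⟩
  have hCne : ∀ k, (C k).Nonempty := by
    intro k
    have hfin : {i | enc i < k}.Finite := (Set.finite_lt_nat k).preimage henc.injOn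
    set s := hfin.toFinset with hs
    -- Since z has zero coordinates, z is almost normed together with all `S.vec i`, and also with
    -- all `-S.vec i`. Averaging the two norming vectors keeps z large and makes every `S.vec i`
    -- small.
    have hnorm : ∀ c : ℝ, |c| = 1 → ‖z + ∑ i ∈ s, c • S.vec i‖ = 1 + s.card := by
      intro c hc
      rw [S.norm_add_sum s z (fun _ => c)]
      simp [hz, hc, hz1, add_comm]
    obtain ⟨f, hf, hfz, hfs⟩ := exists_almost_norming s hz1.le
      (w := fun i => (1 : ℝ) • S.vec i) (fun i => by simpa using hvec i) (hnorm 1 (by simp))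
      (ε := 1 / 8) (by norm_num)
    obtain ⟨f', hf', hfz', hfs'⟩ := exists_almost_norming s hz1.le
      (w := fun i => (-1 : ℝ) • S.vec i) (fun i => by rw [norm_smul]; simpa using hvec i) (hnorm (-1) (by simp))
      (ε := 1 / 8) (by norm_num)
    refine ⟨(1 / 2 : ℝ) • (f + f'), ?_, ?_, fun i hi => ?_⟩
    · rw [norm_smul]
      have := norm_add_le f f'
      norm_num
      linarith
    · rw [map_smul, map_add, smul_eq_mul]; linarith
    · have his : i ∈ s := by simpa [hs] using hi
      have h1 : 1 - 1 / 8 < 1 * S.vec i f := hfs i his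
      have h2 : 1 - 1 / 8 < -1 * S.vec i f' := hfs' i his
      have h3 := apply_le_one (hvec i) hf
      have h4 : -(S.vec i f') ≤ 1 := by
        rw [← map_neg]; exact apply_le_one (hvec i) (by simpa using hf')
      rw [map_smul, map_add, smul_eq_mul, abs_le]
      constructor <;> linarith
  -- Simons' choice: u almost minimizes the norm when it receives all the remaining weight (1/2)^k,
  -- although the sum V then advances by only half of it. The errors, rescaled by 2^k, add up to
  -- 1/8.
  have step : ∀ (k : ℕ) (p : X), ∃ u ∈ C k, ∀ w ∈ C k,
      ‖p + (1 / 2 : ℝ) ^ k • u‖ ≤ ‖p + (1 / 2 : ℝ) ^ k • w‖ + (1 / 4) ^ k / 16 := by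
    intro k p
    have : Nonempty (C k) := (hCne k).to_subtype
    have hbdd : BddBelow (Set.range fun u : C k => ‖p + (1 / 2 : ℝ) ^ k • (u : X)‖) :=
      ⟨0, by rintro _ ⟨u, rfl⟩; exact norm_nonneg _⟩
    obtain ⟨u, hu⟩ := exists_lt_of_ciInf_lt
      (f := fun u : C k => ‖p + (1 / 2 : ℝ) ^ k • (u : X)‖)
      (lt_add_of_pos_right _ (show (0 : ℝ) < (1 / 4) ^ k / 16 by positivity))
    exact ⟨u, u.2, fun w hw => hu.le.trans (add_le_add_left (ciInf_le hbdd ⟨w, hw⟩) _)⟩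
  choose u huC hu using step
  let V : ℕ → X := fun n => Nat.rec 0 (fun k p => p + (1 / 2 : ℝ) ^ (k + 1) • u k p) n
  have hV : ∀ k, V (k + 1) = V k + (1 / 2 : ℝ) ^ (k + 1) • u k (V k) := fun k => rfl
  -- partial sums of a tail
  have tail : ∀ (Φ : X → ℝ) (k : ℕ) (a : ℝ), (∀ x y, Φ (x + y) ≤ Φ x + Φ y) →
      (∀ (c : ℝ) x, 0 < c → Φ (c • x) = c * Φ x) → Φ 0 = 0 → (∀ x ∈ C k, Φ x ≤ a) →
      ∀ n, k ≤ n → Φ (V n - V k) ≤ ((1 / 2) ^ k - (1 / 2) ^ n) * a := by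
    intro Φ k a hadd hmul h0 hle n hn
    induction n, hn using Nat.le_induction with
    | base => simp [h0]
    | succ n hn ih =>
      rw [hV, add_sub_right_comm]
      refine (hadd _ _).trans ?_
      rw [hmul _ _ (by positivity)]
      have h1 := hle _ (hCmono n k hn (huC n (V n)))
      have h2 : (0 : ℝ) < (1 / 2) ^ (n + 1) := by positivity
      have h3 : (1 / 2 : ℝ) ^ n = 2 * (1 / 2) ^ (n + 1) := by rw [pow_succ]; ring
      rw [h3] at ih
      nlinarith
  have hpow : Tendsto (fun n : ℕ => (1 / 2 : ℝ) ^ n) atTop (𝓝 0) :=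
    tendsto_pow_atTop_nhds_zero_of_lt_one (by norm_num) (by norm_num)
  have hcauchy : CauchySeq V := by
    refine cauchySeq_of_le_geometric (1 / 2) 1 (by norm_num) fun n => ?_
    rw [dist_eq_norm, hV, sub_add_cancel_left, norm_neg, norm_smul]
    have h1 := (huC n (V n)).1
    have h2 : (0 : ℝ) < (1 / 2) ^ n := by positivity
    rw [Real.norm_of_nonneg (by positivity), pow_succ]
    nlinarith
  obtain ⟨x, hx⟩ := cauchySeq_tendsto_of_complete hcauchy
  have tail' : ∀ (Φ : X → ℝ) (k : ℕ) (a : ℝ), Continuous Φ → (∀ x y, Φ (x + y) ≤ Φ x + Φ y) →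
      (∀ (c : ℝ) x, 0 < c → Φ (c • x) = c * Φ x) → Φ 0 = 0 → (∀ x ∈ C k, Φ x ≤ a) →
      Φ (x - V k) ≤ (1 / 2) ^ k * a := by
    intro Φ k a hcont hadd hmul h0 hle
    have h1 : Tendsto (fun n => Φ (V n - V k)) atTop (𝓝 (Φ (x - V k))) :=
      (hcont.tendsto _).comp (hx.sub_const _)
    have h2 : Tendsto (fun n : ℕ => ((1 / 2 : ℝ) ^ k - (1 / 2) ^ n) * a) atTop
        (𝓝 (((1 / 2) ^ k - 0) * a)) := (tendsto_const_nhds.sub hpow).mul_const _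
    rw [sub_zero] at h2
    refine le_of_tendsto_of_tendsto h1 h2 ?_
    filter_upwards [eventually_ge_atTop k] with n hn
    exact tail Φ k a hadd hmul h0 hle n hn
  have tailL : ∀ (e : StrongDual ℝ X) (k : ℕ) (a : ℝ), (∀ x ∈ C k, e x ≤ a) →
      e (x - V k) ≤ (1 / 2) ^ k * a := fun e k a h =>
    tail' e k a e.continuous (fun _ _ => (map_add e _ _).le) (fun c y _ => by simp) (map_zero e) h
  -- The constraints defining `C k` are bounds on continuous sublinear functions, so the rescaled
  -- tail, a limit of averages from `C k`, satisfies them. It thus competes in the minimization at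
  -- stage k.
  have hmem : ∀ k, (2 : ℝ) ^ k • (x - V k) ∈ C k := by
    intro k
    have h1 : (1 / 2 : ℝ) ^ k * 2 ^ k = 1 := by rw [← mul_pow]; norm_num
    have h2 : (0 : ℝ) < 2 ^ k := by positivity
    have key : ∀ (e : StrongDual ℝ X) (a : ℝ), (∀ x ∈ C k, e x ≤ a) →
        e ((2 : ℝ) ^ k • (x - V k)) ≤ a := fun e a h => by
      have := mul_le_mul_of_nonneg_left (tailL e k a h) h2.le
      rw [map_smul, smul_eq_mul]
      linear_combination this + a * h1
    refine ⟨?_, ?_, fun i hi => ?_⟩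
    · have h3 := tail' norm k 1 continuous_norm norm_add_le
        (fun c y hc => by rw [norm_smul, Real.norm_of_nonneg hc.le]) norm_zero fun y hy => hy.1
      rw [norm_smul, Real.norm_of_nonneg h2.le]
      nlinarith
    · have := key (-z) (-(1 / 2)) fun y hy => by
        have := hy.2.1
        rw [neg_apply]
        linarith
      rw [neg_apply] at this
      linarith
    · rw [abs_le]
      constructor
      · have := key (-S.vec i) (1 / 8) fun y hy => by
          have := (abs_le.1 (hy.2.2 i hi)).1
          rw [neg_apply]
          linarith
        rw [neg_apply] at this
        linarith
      · exact key (S.vec i) (1 / 8) fun y hy => (abs_le.1 (hy.2.2 i hi)).2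
  have hzx : 1 / 2 ≤ z x := by
    have h1 := (hmem 0).2.1
    simpa [V] using h1
  have hx0 : x ≠ 0 := by
    rintro rfl
    rw [map_zero] at hzx
    norm_num at hzx
  have hxn : 1 / 2 ≤ ‖x‖ := by
    have h1 := (le_abs_self _).trans (z.le_opNorm x)
    rw [hz1] at h1
    linarith
  obtain ⟨i, hi⟩ := hb x hx0
  obtain ⟨c, hc, hcx⟩ : ∃ c : ℝ, |c| = 1 ∧ c * S.vec i x = ‖x‖ := by
    rcases abs_cases (S.vec i x) with h | h
    · exact ⟨1, by simp, by linarith⟩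
    · exact ⟨-1, by simp, by linarith⟩
  set e : StrongDual ℝ X := c • S.vec i with he
  have hen : ‖e‖ = 1 := by rw [he, norm_smul, Real.norm_eq_abs, hc, S.norm_vec, one_mul]
  have hex : e x = ‖x‖ := hcx
  have hrec : ∀ k, e (x - V k) ≤ 2 * e (x - V (k + 1)) + (1 / 4) ^ k / 16 := by
    intro k
    have h1 := hu k (V k) _ (hmem k)
    have h2 : V k + (1 / 2 : ℝ) ^ k • (2 : ℝ) ^ k • (x - V k) = x := by
      rw [smul_smul, ← mul_pow]
      norm_num
    have h3 : V k + (1 / 2 : ℝ) ^ k • u k (V k) = (2 : ℝ) • V (k + 1) - V k := by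
      have h4 : (1 / 2 : ℝ) ^ k = 2 * (1 / 2) ^ (k + 1) := by rw [pow_succ]; ring
      rw [h4, hV, smul_add, smul_smul, two_smul]
      abel
    rw [h2, h3] at h1
    have h5 := (le_abs_self _).trans (e.le_opNorm ((2 : ℝ) • V (k + 1) - V k))
    rw [hen, one_mul, map_sub, map_smul, smul_eq_mul] at h5
    rw [map_sub, map_sub]
    linarith
  -- The rescaled tails start at e x = ‖x‖ ≥ 1/2 and lose at most (1/2)^k / 16 at stage k, so they
  -- stay above 3/8. Yet once k exceeds `enc i`, membership in `C k` bounds them by 1/8.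
  have hlow : ∀ k : ℕ, 3 / 8 + (1 / 2) ^ k / 8 ≤ 2 ^ k * e (x - V k) := by
    intro k
    induction k with
    | zero =>
      have : V 0 = 0 := rfl
      rw [this, sub_zero, hex]
      norm_num
      linarith
    | succ k ih =>
      have h1 := mul_le_mul_of_nonneg_left (hrec k) (show (0 : ℝ) ≤ 2 ^ k by positivity)
      have h2 : (2 : ℝ) ^ k * ((1 / 4) ^ k / 16) = (1 / 2) ^ k / 16 := by
        rw [← mul_div_assoc, ← mul_pow]; norm_num
      rw [mul_add, h2] at h1
      rw [pow_succ, pow_succ]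
      linarith
  have hup : 2 ^ (enc i + 1) * e (x - V (enc i + 1)) ≤ 1 / 8 := by
    have h1 := (hmem (enc i + 1)).2.2 i (Nat.lt_succ_self _)
    have h2 : 2 ^ (enc i + 1) * e (x - V (enc i + 1)) =
        c * S.vec i ((2 : ℝ) ^ (enc i + 1) • (x - V (enc i + 1))) := by
      rw [map_smul, he, smul_apply, smul_eq_mul, smul_eq_mul]; ring
    rw [h2]
    refine (le_abs_self _).trans ?_
    rw [abs_mul, hc, one_mul]
    exact h1
  have h1 := hlow (enc i + 1)
  have h2 : (0 : ℝ) < (1 / 2) ^ (enc i + 1) := by positivity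
  linarith

lemma LSystem.coord_eq_of_hasSum {ι V : Type*} [NormedAddCommGroup V]
    [NormedSpace ℝ V] (S : LSystem ι V) {c : ι → ℝ} {x : V} (h : HasSum (fun i => c i • S.vec i) x) (j : ι) :
    S.coord j x = c j := by
  have h1 := h.map (S.coord j) (S.continuous_coord j)
  have h2 := hasSum_single (f := ⇑(S.coord j) ∘ fun i => c i • S.vec i) j
    fun k hk => by simp [S.coord_ne j k hk.symm]
  rw [h1.unique h2]
  simp [S.coord_self]

/-- The coordinate series converges absolutely and the remainder has zero coordinates; a nonzero
remainder could be normalized to contradict the hypothesis. -/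
lemma LSystem.hasSum_coord {ι V : Type*} [NormedAddCommGroup V] [NormedSpace ℝ V]
    [CompleteSpace V] (S : LSystem ι V) (h : ∀ z, (∀ i, S.coord i z = 0) → ‖z‖ ≠ 1) (x : V) :
    HasSum (fun i => S.coord i x • S.vec i) x := by
  classical
  have hs : Summable fun i => S.coord i x • S.vec i :=
    Summable.of_norm (by simpa [norm_smul, S.norm_vec] using S.summable_abs_coord x)
  set y := x - ∑' i, S.coord i x • S.vec i with hy
  have hc : ∀ j, S.coord j y = 0 := fun j => by
    rw [hy, map_sub, S.coord_eq_of_hasSum hs.hasSum j, sub_self]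
  have hy0 : y = 0 := by
    by_contra hy0
    have hp := norm_pos_iff.2 hy0
    refine h (‖y‖⁻¹ • y) (fun i => by rw [map_smul, hc, smul_zero]) ?_
    rw [norm_smul, norm_inv, norm_norm, inv_mul_cancel₀ hp.ne']
  rw [sub_eq_zero] at hy0
  have := hs.hasSum
  rwa [← hy0] at this

end Boundary

/-! ### Asymptotic additivity of the norm -/

section Asymptotic

namespace LSystem

variable {ι V : Type*} [NormedAddCommGroup V] [NormedSpace ℝ V] (S : LSystem ι V)

lemma hasSum_abs_coord {x : V} (h : HasSum (fun i => S.coord i x • S.vec i) x) :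
    HasSum (fun i => |S.coord i x|) ‖x‖ := by
  have h1 : Tendsto (fun s : Finset ι => ‖x‖ - ‖x - ∑ i ∈ s, S.coord i x • S.vec i‖)
      (SummationFilter.unconditional ι).filter (𝓝 (‖x‖ - ‖x - x‖)) :=
    tendsto_const_nhds.sub (tendsto_const_nhds.sub h).norm
  rw [sub_self, norm_zero, sub_zero] at h1
  refine h1.congr fun s => ?_
  rw [S.norm_eq_sum s x]
  ring

/-- A quantitative form of disjointness: the loss is controlled by the part of b off s and the part
of a on s. -/
lemma norm_add_ge (s : Finset ι) (a b : V) :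
    ‖a‖ + ‖b‖ - 2 * ‖b - ∑ i ∈ s, S.coord i b • S.vec i‖ - 2 * ∑ i ∈ s, |S.coord i a| ≤
      ‖a + b‖ := by
  have ha := S.norm_eq_sum s a
  have hb := S.norm_eq_sum s b
  have hab := S.norm_eq_sum s (a + b)
  have h1 : a + b - ∑ i ∈ s, S.coord i (a + b) • S.vec i =
      (a - ∑ i ∈ s, S.coord i a • S.vec i) - -(b - ∑ i ∈ s, S.coord i b • S.vec i) := by
    simp only [map_add, add_smul, Finset.sum_add_distrib]
    abel
  have h2 := norm_sub_norm_le (a - ∑ i ∈ s, S.coord i a • S.vec i)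
    (-(b - ∑ i ∈ s, S.coord i b • S.vec i))
  rw [← h1, norm_neg] at h2
  have h3 : ∑ i ∈ s, |S.coord i b| - ∑ i ∈ s, |S.coord i a| ≤ ∑ i ∈ s, |S.coord i (a + b)| := by
    rw [← Finset.sum_sub_distrib]
    refine Finset.sum_le_sum fun i _ => ?_
    have := abs_sub_abs_le_abs_sub (S.coord i b) (-(S.coord i a))
    rw [abs_neg, sub_neg_eq_add] at this
    rwa [map_add, add_comm (S.coord i a)]
  linarith

/-- Norms of coordinatewise null sequences are asymptotically additive. -/
lemma tendsto_norm_add_sub_norm {α : Type*} {l : Filter α} {a : α → V}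
    (ha : ∀ i, Tendsto (fun n => S.coord i (a n)) l (𝓝 0)) {b : V}
    (hb : HasSum (fun i => S.coord i b • S.vec i) b) :
    Tendsto (fun n => ‖a n + b‖ - ‖a n‖) l (𝓝 ‖b‖) := by
  rw [Metric.tendsto_nhds]
  intro ε hε
  have h1 : Tendsto (fun s : Finset ι => ‖b - ∑ i ∈ s, S.coord i b • S.vec i‖)
      (SummationFilter.unconditional ι).filter (𝓝 ‖b - b‖) := (tendsto_const_nhds.sub hb).norm
  rw [sub_self, norm_zero] at h1
  obtain ⟨s, hs⟩ := (h1.eventually (gt_mem_nhds (show 0 < ε / 4 by positivity))).exists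
  have h2 : Tendsto (fun n => ∑ i ∈ s, |S.coord i (a n)|) l (𝓝 (∑ i ∈ s, |(0 : ℝ)|)) :=
    tendsto_finsetSum _ fun i _ => (ha i).abs
  rw [abs_zero, Finset.sum_const_zero] at h2
  filter_upwards [h2.eventually (gt_mem_nhds (show 0 < ε / 4 by positivity))] with n hn
  rw [Real.dist_eq, abs_lt]
  constructor
  · linarith [S.norm_add_ge s (a n) b]
  · linarith [norm_add_le (a n) b]

end LSystem

end Asymptotic

/-! ### Minimal invariant sets and approximate fixed points -/

section FixedPoint

variable {X : Type u} [NormedAddCommGroup X] [NormedSpace ℝ X]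

lemma IsWeakStarCompact.inter_closedBall {K : Set (StrongDual ℝ X)} (hK : IsWeakStarCompact K)
    (u : StrongDual ℝ X) (r : ℝ) : IsWeakStarCompact (K ∩ Metric.closedBall u r) := by
  unfold IsWeakStarCompact at hK ⊢
  rw [Set.image_inter StrongDual.toWeakDual.injective]
  refine hK.inter_right ?_
  have := WeakDual.isClosed_closedBall (𝕜 := ℝ) (E := X) u r
  convert this using 1
  exact StrongDual.toWeakDual.image_eq_preimage_symm _

lemma IsWeakStarCompact.isClosed {K : Set (StrongDual ℝ X)} (hK : IsWeakStarCompact K) :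
    IsClosed K := by
  have h1 : Continuous (StrongDual.toWeakDual : StrongDual ℝ X → WeakDual ℝ X) :=
    NormedSpace.Dual.toWeakDual_continuous
  have h2 := (IsCompact.isClosed hK).preimage h1
  rwa [Set.preimage_image_eq _ StrongDual.toWeakDual.injective] at h2

lemma IsWeakStarCompact.exists_norm_le [CompleteSpace X] {K : Set (StrongDual ℝ X)}
    (hK : IsWeakStarCompact K) : ∃ M, ∀ x ∈ K, ‖x‖ ≤ M := by
  obtain ⟨M, hM⟩ := banach_steinhaus (g := fun x : K => (x : StrongDual ℝ X)) fun f => by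
    have h1 : IsCompact ((fun y : WeakDual ℝ X => y f) '' (StrongDual.toWeakDual '' K)) :=
      IsCompact.image hK (continuous_weakDual_eval f)
    obtain ⟨C, hC⟩ := h1.isBounded.exists_norm_le
    exact ⟨C, fun x => hC _ ⟨_, ⟨x, x.2, rfl⟩, rfl⟩⟩
  exact ⟨M, fun x hx => hM ⟨x, hx⟩⟩

/-- Existence of minimal invariant weak-star compact convex sets. -/
lemma exists_minimal_invariant {K : Set (StrongDual ℝ X)} (hne : K.Nonempty) (hconv : Convex ℝ K)
    (hK : IsWeakStarCompact K) {f : StrongDual ℝ X → StrongDual ℝ X} (hf : Set.MapsTo f K K) :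
    ∃ L ⊆ K, L.Nonempty ∧ Convex ℝ L ∧ IsWeakStarCompact L ∧ Set.MapsTo f L L ∧
      ∀ L' ⊆ L, L'.Nonempty → Convex ℝ L' → IsWeakStarCompact L' → Set.MapsTo f L' L' →
        L ⊆ L' := by
  let F : Set (Set (StrongDual ℝ X)) :=
    {L | L.Nonempty ∧ Convex ℝ L ∧ IsWeakStarCompact L ∧ Set.MapsTo f L L}
  obtain ⟨L, hLK, hL⟩ := zorn_superset_nonempty F (fun c hcF hc hcne => by
    have hinj := (StrongDual.toWeakDual (𝕜 := ℝ) (E := X)).injective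
    have himage : StrongDual.toWeakDual '' ⋂₀ c =
        ⋂₀ ((fun L => StrongDual.toWeakDual (𝕜 := ℝ) (E := X) '' L) '' c) := by
      rw [Set.sInter_image, Set.sInter_eq_biInter, Set.image_iInter₂
        (StrongDual.toWeakDual (𝕜 := ℝ) (E := X)).bijective]
    have hcompact : ∀ W ∈ (fun L => StrongDual.toWeakDual (𝕜 := ℝ) (E := X) '' L) '' c,
        IsCompact W := by
      rintro _ ⟨L, hL, rfl⟩
      exact (hcF hL).2.2.1
    have hne' : (⋂₀ ((fun L => StrongDual.toWeakDual (𝕜 := ℝ) (E := X) '' L) '' c)).Nonempty := by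
      have := (hcne.image fun L => StrongDual.toWeakDual (𝕜 := ℝ) (E := X) '' L).to_subtype
      refine IsCompact.nonempty_sInter_of_directed_nonempty_isCompact_isClosed ?_ ?_
        hcompact (fun W hW => (hcompact W hW).isClosed)
      · rintro _ ⟨L, hL, rfl⟩ _ ⟨L', hL', rfl⟩
        rcases hc.total hL hL' with h | h
        · exact ⟨_, ⟨L, hL, rfl⟩, subset_rfl, Set.image_mono h⟩
        · exact ⟨_, ⟨L', hL', rfl⟩, Set.image_mono h, subset_rfl⟩
      · rintro _ ⟨L, hL, rfl⟩
        exact (hcF hL).1.image _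
    refine ⟨⋂₀ c, ⟨?_, convex_sInter fun L hL => (hcF hL).2.1, ?_, fun x hx L hL =>
      (hcF hL).2.2.2 (hx L hL)⟩, fun L hL => Set.sInter_subset_of_mem hL⟩
    · rw [← himage] at hne'
      exact hne'.of_image
    · unfold IsWeakStarCompact
      rw [himage]
      obtain ⟨L, hL⟩ := hcne
      exact (hcompact _ ⟨L, hL, rfl⟩).of_isClosed_subset
        (isClosed_sInter fun W hW => (hcompact W hW).isClosed)
        (Set.sInter_subset_of_mem ⟨L, hL, rfl⟩)) K ⟨hne, hconv, hK, hf⟩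
  exact ⟨L, hLK, hL.prop.1, hL.prop.2.1, hL.prop.2.2.1, hL.prop.2.2.2,
    fun L' hL' h1 h2 h3 h4 => hL.le_of_le ⟨h1, h2, h3, h4⟩ hL'⟩

/-- Mixing f with a small multiple t of a constant map gives a contraction; its fixed point is moved
by f at most 2tM. -/
lemma exists_approx_fixedPoint {V : Type*} [NormedAddCommGroup V] [NormedSpace ℝ V]
    [CompleteSpace V] {L : Set V} (hne : L.Nonempty) (hconv : Convex ℝ L) (hcl : IsClosed L)
    {M : ℝ} (hM : ∀ x ∈ L, ‖x‖ ≤ M) {f : V → V} (hf : Set.MapsTo f L L)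
    (hfn : ∀ x ∈ L, ∀ y ∈ L, ‖f x - f y‖ ≤ ‖x - y‖) {ε : ℝ} (hε : 0 < ε) :
    ∃ x ∈ L, ‖x - f x‖ ≤ ε := by
  obtain ⟨x₀, hx₀⟩ := hne
  have hM0 : 0 ≤ M := (norm_nonneg _).trans (hM x₀ hx₀)
  obtain ⟨t, ht0, ht1, htε⟩ : ∃ t : ℝ, 0 < t ∧ t < 1 ∧ t * (2 * M) ≤ ε := by
    refine ⟨min (1 / 2) (ε / (2 * M + 1)), by positivity,
      (min_le_left _ _).trans_lt (by norm_num), ?_⟩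
    calc min (1 / 2) (ε / (2 * M + 1)) * (2 * M) ≤ ε / (2 * M + 1) * (2 * M + 1) := by
          gcongr
          · exact min_le_right _ _
          · linarith
      _ = ε := div_mul_cancel₀ _ (by positivity)
  set g : V → V := fun x => (1 - t) • f x + t • x₀ with hg
  have hgL : Set.MapsTo g L L := fun x hx =>
    hconv (hf hx) hx₀ (by linarith) ht0.le (by ring)
  have hcontr : ContractingWith (1 - t).toNNReal (hgL.restrict g L L) := by
    refine ⟨by simpa using ht0, LipschitzWith.of_dist_le_mul fun x y => ?_⟩
    change dist (g x) (g y) ≤ (1 - t).toNNReal * dist (x : V) y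
    rw [Real.coe_toNNReal _ (by linarith), dist_eq_norm, dist_eq_norm, hg]
    simp only [add_sub_add_right_eq_sub, ← smul_sub]
    rw [norm_smul, Real.norm_of_nonneg (by linarith)]
    exact mul_le_mul_of_nonneg_left (hfn x x.2 y y.2) (by linarith)
  obtain ⟨x, hxL, hx, -⟩ := hcontr.exists_fixedPoint' hcl.isComplete hgL hx₀ (edist_ne_top _ _)
  refine ⟨x, hxL, ?_⟩
  have hx' : (1 - t) • f x + t • x₀ = x := hx
  have h1 : x - f x = t • (x₀ - f x) := by
    nth_rewrite 1 [← hx']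
    rw [sub_smul, one_smul, smul_sub]
    abel
  rw [h1, norm_smul, Real.norm_of_nonneg ht0.le]
  refine le_trans ?_ htε
  have h2 := norm_sub_le x₀ (f x)
  have h3 := hM _ (hf hxL)
  have h4 := hM _ hx₀
  gcongr
  linarith

lemma Ultrafilter.exists_tendsto_of_abs_le {α : Type*} (l : Ultrafilter α) {a : α → ℝ} {M : ℝ}
    (h : ∀ n, |a n| ≤ M) : ∃ c, Tendsto a l (𝓝 c) := by
  obtain ⟨c, -, hc⟩ := (isCompact_Icc (a := -M) (b := M)).ultrafilter_le_nhds (l.map a) (by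
    rw [le_principal_iff]
    exact mem_map.2 (Eventually.of_forall fun n => abs_le.1 (h n)))
  exact ⟨c, hc⟩

end FixedPoint

/-! ### From a fixed-point-free map to an infinite set of extreme points -/

section Main

variable {X : Type u} [NormedAddCommGroup X] [NormedSpace ℝ X]

/-- If the dual is spanned by an `LSystem` and a nonexpansive map on a minimal weak-star compact
convex invariant set has no fixed point, this set is contained in a sphere whose center is the
coordinatewise limit of approximate fixed points. -/
lemma LSystem.exists_center_of_minimal [CompleteSpace X] {ι : Type*}
    (S : LSystem ι (StrongDual ℝ X)) (hS : ∀ x, HasSum (fun i => S.coord i x • S.vec i) x)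
    {L : Set (StrongDual ℝ X)} (hne : L.Nonempty) (hconv : Convex ℝ L) (hL : IsWeakStarCompact L)
    {f : StrongDual ℝ X → StrongDual ℝ X} (hf : Set.MapsTo f L L)
    (hfn : ∀ x ∈ L, ∀ y ∈ L, ‖f x - f y‖ ≤ ‖x - y‖)
    (hmin : ∀ L' ⊆ L, L'.Nonempty → Convex ℝ L' → IsWeakStarCompact L' → Set.MapsTo f L' L' →
      L ⊆ L')
    (hfix : ∀ x ∈ L, f x ≠ x) :
    ∃ (u p : StrongDual ℝ X) (ρ : ℝ) (x : ℕ → StrongDual ℝ X) (l : Ultrafilter ℕ),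
      0 < ρ ∧ (∀ y ∈ L, ‖y - u‖ = ρ) ∧ p ∈ L ∧ (∀ n, x n ∈ L) ∧
      (∀ i, Tendsto (fun n => S.coord i (x n - u)) l (𝓝 0)) ∧
      ∀ g : X, Tendsto (fun n => x n g) l (𝓝 (p g)) := by
  obtain ⟨M, hM⟩ := hL.exists_norm_le
  choose x hxL hx using fun n : ℕ => exists_approx_fixedPoint hne hconv hL.isClosed hM hf hfn
    (show (0 : ℝ) < 1 / ((n : ℝ) + 1) by positivity)
  -- An ultrafilter provides the limits of all coordinates, of the norms and of the weak-star values
  -- at once. The coordinatewise limit u may differ from the weak-star limit p.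
  set l : Ultrafilter ℕ := hyperfilter ℕ with hl
  have hlat : (l : Filter ℕ) ≤ atTop := Nat.hyperfilter_le_atTop
  have happrox : Tendsto (fun n => ‖x n - f (x n)‖) l (𝓝 0) :=
    (squeeze_zero (fun n => norm_nonneg _) hx tendsto_one_div_add_atTop_nhds_zero_nat).mono_left
      hlat
  -- the coordinatewise limit
  have hcoord : ∀ i, ∃ c, Tendsto (fun n => S.coord i (x n)) l (𝓝 c) := fun i =>
    l.exists_tendsto_of_abs_le fun n => (S.abs_coord_le i (x n)).trans (hM _ (hxL n))
  choose c hc using hcoord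
  have hcs : Summable fun i => c i • S.vec i := by
    refine Summable.of_norm ?_
    simp only [norm_smul, S.norm_vec, mul_one]
    refine summable_of_sum_le (c := M) (fun _ => norm_nonneg _) fun s => ?_
    refine le_of_tendsto (tendsto_finsetSum s fun i _ => (hc i).norm) (Eventually.of_forall ?_)
    exact fun n => (S.sum_abs_coord_le s (x n)).trans (hM _ (hxL n))
  obtain ⟨u, hu⟩ := hcs
  have hcu : ∀ i, S.coord i u = c i := S.coord_eq_of_hasSum hu
  have hnull : ∀ i, Tendsto (fun n => S.coord i (x n - u)) l (𝓝 0) := fun i => by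
    have := (hc i).sub_const (c i)
    rw [sub_self] at this
    simpa only [map_sub, hcu] using this
  obtain ⟨r, hr⟩ := l.exists_tendsto_of_abs_le (a := fun n => ‖x n - u‖) (M := M + ‖u‖) fun n => by
    rw [abs_norm]
    exact (norm_sub_le _ _).trans (by gcongr; exact hM _ (hxL n))
  -- The asymptotic distance to the approximate fixed points is the distance to u plus a constant,
  -- so f cannot increase the distance to u. Balls around u then cut out invariant subsets, and
  -- minimality makes that distance constant on L.
  have hlim : ∀ y, Tendsto (fun n => ‖x n - y‖) l (𝓝 (r + ‖y - u‖)) := fun y => by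
    have h1 := hr.add (S.tendsto_norm_add_sub_norm hnull (hS (u - y)))
    rw [norm_sub_rev y u]
    refine h1.congr fun n => ?_
    rw [sub_add_sub_cancel]
    ring
  have hfu : ∀ y ∈ L, ‖f y - u‖ ≤ ‖y - u‖ := by
    intro y hy
    have h1 := happrox.add (hlim y)
    have h2 := le_of_tendsto_of_tendsto' (hlim (f y)) h1 fun n =>
      calc ‖x n - f y‖ = ‖(x n - f (x n)) + (f (x n) - f y)‖ := by rw [sub_add_sub_cancel]
        _ ≤ ‖x n - f (x n)‖ + ‖f (x n) - f y‖ := norm_add_le _ _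
        _ ≤ ‖x n - f (x n)‖ + ‖x n - y‖ := by gcongr; exact hfn _ (hxL n) _ hy
    linarith
  have hconst : ∀ y ∈ L, ∀ z ∈ L, ‖z - u‖ ≤ ‖y - u‖ := by
    intro y hy z hz
    have h1 := hmin (L ∩ Metric.closedBall u ‖y - u‖) Set.inter_subset_left
      ⟨y, hy, by simp [dist_eq_norm]⟩ (hconv.inter (convex_closedBall _ _))
      (hL.inter_closedBall _ _) (fun w hw => ⟨hf hw.1, by
        have h2 := hw.2
        rw [mem_closedBall_iff_norm] at h2 ⊢
        exact (hfu w hw.1).trans h2⟩) hz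
    exact mem_closedBall_iff_norm.1 h1.2
  obtain ⟨y₀, hy₀⟩ := hne
  have hρ : ∀ y ∈ L, ‖y - u‖ = ‖y₀ - u‖ := fun y hy =>
    le_antisymm (hconst _ hy₀ _ hy) (hconst _ hy _ hy₀)
  have hpos : 0 < ‖y₀ - u‖ := by
    rw [norm_pos_iff]
    intro h0
    rw [h0, norm_zero] at hρ
    have h1 := sub_eq_zero.1 (norm_eq_zero.1 (hρ _ hy₀))
    have h2 := sub_eq_zero.1 (norm_eq_zero.1 (hρ _ (hf hy₀)))
    exact hfix y₀ hy₀ (h2.trans h1.symm)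
  obtain ⟨_, ⟨p, hpL, rfl⟩, hp⟩ := IsCompact.ultrafilter_le_nhds hL
    (l.map fun n => StrongDual.toWeakDual (x n)) (by
      rw [le_principal_iff]
      exact mem_map.2 (Eventually.of_forall fun n => ⟨x n, hxL n, rfl⟩))
  exact ⟨u, p, ‖y₀ - u‖, x, l, hpos, hρ, hpL, hxL, hnull, fun g =>
    ((continuous_weakDual_eval g).tendsto (StrongDual.toWeakDual p)).comp hp⟩

/-- Convexity on a sphere makes norms additive on L - u, so each coordinate has a constant sign
there and can be made nonnegative. The points x n - u tend to zero coordinatewise, so no finite part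
of the system contributes to their weak-star limit p - u. -/
lemma LSystem.exists_infinite_of_sphere {ι : Type*}
    (S : LSystem ι (StrongDual ℝ X)) (hS : ∀ x, HasSum (fun i => S.coord i x • S.vec i) x)
    {L : Set (StrongDual ℝ X)} (hconv : Convex ℝ L)
    {u p : StrongDual ℝ X} {ρ : ℝ} {x : ℕ → StrongDual ℝ X} {l : Ultrafilter ℕ}
    (hρ : 0 < ρ) (hL : ∀ y ∈ L, ‖y - u‖ = ρ) (hp : p ∈ L) (hx : ∀ n, x n ∈ L)
    (hnull : ∀ i, Tendsto (fun n => S.coord i (x n - u)) l (𝓝 0))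
    (hlim : ∀ g : X, Tendsto (fun n => x n g) l (𝓝 (p g))) :
    ∃ C : Set (StrongDual ℝ X), C.Infinite ∧ (∀ e ∈ C, ∃ i, e = S.vec i ∨ e = -S.vec i) ∧
      weakStarClosure (convexHull ℝ C) ⊆ Metric.sphere (0 : StrongDual ℝ X) 1 := by
  classical
  -- elements of `L - u` have coherent signs
  have hmul : ∀ a ∈ L, ∀ b ∈ L, ∀ i, 0 ≤ S.coord i (a - u) * S.coord i (b - u) := by
    intro a ha b hb i
    refine S.coord_mul_nonneg ?_ i
    have h1 := hL _ (hconv ha hb (a := 1 / 2) (b := 1 / 2) (by norm_num) (by norm_num)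
      (by norm_num))
    have h2 : (1 / 2 : ℝ) • a + (1 / 2 : ℝ) • b - u = (1 / 2 : ℝ) • ((a - u) + (b - u)) := by
      module
    rw [h2, norm_smul] at h1
    rw [hL a ha, hL b hb]
    norm_num at h1
    linarith
  set σ : ι → ℝ := fun i => if ∃ a ∈ L, S.coord i (a - u) < 0 then -1 else 1 with hσ
  have hσ1 : ∀ i, |σ i| = 1 := fun i => by simp only [hσ]; split_ifs <;> simp
  have hσσ : ∀ i, σ i * σ i = 1 := fun i => by rw [← abs_mul_abs_self, hσ1]; norm_num
  have hσn : ∀ i, ∀ b ∈ L, 0 ≤ σ i * S.coord i (b - u) := by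
    intro i b hb
    simp only [hσ]
    split_ifs with h
    · obtain ⟨a, ha, hneg⟩ := h
      have := hmul a ha b hb i
      nlinarith
    · push Not at h
      rw [one_mul]
      exact h b hb
  set S' := S.changeSigns σ hσ1 with hS'
  have hvec : ∀ i, S'.vec i = σ i • S.vec i := fun i => rfl
  have hcoord : ∀ i y, S'.coord i y = σ i * S.coord i y := fun i y => rfl
  have hsum : ∀ y, HasSum (fun i => S'.coord i y • S'.vec i) y := fun y => by
    refine (hS y).congr_fun fun i => ?_
    rw [hvec, hcoord, smul_smul, mul_right_comm, hσσ, one_mul]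
  have hnonneg : ∀ i, ∀ b ∈ L, 0 ≤ S'.coord i (ρ⁻¹ • (b - u)) := fun i b hb => by
    rw [map_smul, hcoord, smul_eq_mul]
    exact mul_nonneg (inv_nonneg.2 hρ.le) (hσn i b hb)
  have hone : ∀ b ∈ L, ‖ρ⁻¹ • (b - u)‖ = 1 := fun b hb => by
    rw [norm_smul, hL b hb, Real.norm_of_nonneg (inv_nonneg.2 hρ.le), inv_mul_cancel₀ hρ.ne']
  obtain ⟨C, hC1, hC2, hC3⟩ := S'.exists_infinite_subset (hone p hp)
    (fun i => hnonneg i p hp) (fun s g t ht => by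
      by_contra! hno
      set z : ℕ → StrongDual ℝ X := fun n => ρ⁻¹ • (x n - u) with hz
      have hzg : Tendsto (fun n => z n g) l (𝓝 ((ρ⁻¹ • (p - u)) g)) :=
        ((hlim g).sub_const (u g)).const_mul ρ⁻¹
      -- Each z n is an infinite convex combination of the vectors of `S'`. If all those outside s
      -- take values at most t at g, any excess over t comes from s, where the weights tend to 0.
      have hle : ∀ n, z n g - t ≤ ∑ i ∈ s, S'.coord i (z n) * (S'.vec i g - t) := by
        intro n
        have h1 : HasSum (fun i => S'.coord i (z n)) 1 := by
          have := S'.hasSum_abs_coord (hsum (z n))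
          rw [hone _ (hx n)] at this
          refine this.congr_fun fun i => ?_
          exact (abs_of_nonneg (hnonneg i _ (hx n))).symm
        have h2 : HasSum (fun i => S'.coord i (z n) * S'.vec i g) (z n g) :=
          (hsum (z n)).mapL (ContinuousLinearMap.apply ℝ ℝ g)
        have h3 := (h1.mul_right t).sub h2
        have h4 := sum_le_hasSum s (fun i hi => by
          have h5 := hnonneg i _ (hx n)
          have h6 := hno i hi
          rw [← mul_sub]
          exact mul_nonneg h5 (sub_nonneg.2 h6)) h3
        simp only [← mul_sub, one_mul] at h4
        have h7 : ∑ i ∈ s, S'.coord i (z n) * (S'.vec i g - t) =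
            -∑ i ∈ s, S'.coord i (z n) * (t - S'.vec i g) := by
          rw [← Finset.sum_neg_distrib]
          exact Finset.sum_congr rfl fun i _ => by ring
        rw [h7]
        linarith
      have hzero : Tendsto (fun n => ∑ i ∈ s, S'.coord i (z n) * (S'.vec i g - t)) l
          (𝓝 (∑ i ∈ s, (0 : ℝ) * (S'.vec i g - t))) := by
        refine tendsto_finsetSum s fun i _ => Tendsto.mul_const _ ?_
        have := ((hnull i).const_mul (σ i)).const_mul ρ⁻¹
        rw [mul_zero, mul_zero] at this
        refine this.congr fun n => ?_
        rw [hz, map_smul, hcoord, smul_eq_mul]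
      simp only [zero_mul, Finset.sum_const_zero] at hzero
      have := le_of_tendsto_of_tendsto' (hzg.sub_const t) hzero hle
      linarith)
  refine ⟨C, hC1, fun e he => ?_, hC3⟩
  obtain ⟨i, rfl⟩ := hC2 he
  refine ⟨i, ?_⟩
  rw [hvec]
  rcases abs_eq (zero_le_one) |>.1 (hσ1 i) with h | h
  · left; rw [h, one_smul]
  · right
    rw [h]
    ext g
    change -1 * S.vec i g = -(S.vec i g)
    ring

lemma exists_infinite_of_not_hasWeakStarFPP [CompleteSpace X] [TopologicalSpace.SeparableSpace X]
    (hat : ∀ e ∈ Set.extremePoints ℝ (Metric.closedBall (0 : StrongDual ℝ X) 1), e ≠ 0 →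
      IsLAtom e) (hF : ¬ HasWeakStarFPP X) :
    ∃ C : Set (StrongDual ℝ X), C.Infinite ∧
      C ⊆ Set.extremePoints ℝ (Metric.closedBall (0 : StrongDual ℝ X) 1) ∧
      weakStarClosure (convexHull ℝ C) ⊆ Metric.sphere (0 : StrongDual ℝ X) 1 := by
  classical
  set E := Set.extremePoints ℝ (Metric.closedBall (0 : StrongDual ℝ X) 1) with hE
  by_cases hc : E.Countable
  swap
  · exact exists_infinite_of_not_countable hat hc
  have hneg : ∀ e ∈ E, -e ∈ E := fun e he => by
    have h := image_extremePoints (𝕜 := ℝ) (LinearEquiv.neg ℝ (M := StrongDual ℝ X))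
      (Metric.closedBall (0 : StrongDual ℝ X) 1)
    have h2 : LinearEquiv.neg ℝ (M := StrongDual ℝ X) '' Metric.closedBall 0 1 =
        Metric.closedBall 0 1 := by
      change (fun x : StrongDual ℝ X => -x) '' Metric.closedBall 0 1 = _
      simp
    rw [h2] at h
    rw [hE, ← h]
    exact ⟨e, he, rfl⟩
  -- one extreme point of each antipodal pair
  let G : Set (StrongDual ℝ X) := {e | e ∈ E ∧ WellOrderingRel e (-e)}
  have hGE : G ⊆ E := fun e he => he.1
  have hGneg : ∀ e ∈ G, -e ∉ G := fun e he hne => by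
    have h := hne.2
    rw [neg_neg] at h
    exact asymm_of WellOrderingRel he.2 h
  have hG0 : ∀ e ∈ G, e ≠ 0 := by
    rintro e he rfl
    exact hGneg 0 he (by rwa [neg_zero])
  have hEG : ∀ e ∈ E, e ≠ 0 → e ∈ G ∨ -e ∈ G := by
    intro e he he0
    rcases trichotomous_of WellOrderingRel e (-e) with h | h | h
    · exact Or.inl ⟨he, h⟩
    · refine absurd (ContinuousLinearMap.ext fun g => ?_) he0
      have h1 : e g = -(e g) := DFunLike.congr_fun h g
      change e g = 0
      linarith
    · exact Or.inr ⟨hneg e he, by rwa [neg_neg]⟩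
  set S := LSystem.ofSet G hGE (fun e he => hat e (hGE he) (hG0 e he)) hGneg with hS
  have hvec : ∀ i : G, S.vec i = i := fun i => rfl
  have : Countable G := (hc.mono hGE).to_subtype
  have hsum : ∀ x, HasSum (fun i => S.coord i x • S.vec i) x :=
    S.hasSum_coord fun z => S.eq_zero_of_coord_eq_zero fun g hg => by
      obtain ⟨e, he, heg⟩ := exists_mem_extremePoints_apply_eq_norm g
      have he0 : e ≠ 0 := by
        rintro rfl
        exact hg (norm_eq_zero.1 (by rw [← heg]; rfl))
      rcases hEG e he he0 with h | h
      · exact ⟨⟨e, h⟩, by rw [hvec, heg, abs_norm]⟩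
      · exact ⟨⟨-e, h⟩, by rw [hvec, neg_apply, abs_neg, heg, abs_norm]⟩
  unfold HasWeakStarFPP HasFPP at hF
  push Not at hF
  obtain ⟨K, hKne, hKconv, hK, T, hT, hTfix⟩ := hF
  -- The values outside K are irrelevant; a total map only avoids subtypes when passing to the
  -- minimal set.
  set f : StrongDual ℝ X → StrongDual ℝ X := fun x => if h : x ∈ K then T ⟨x, h⟩ else x with hf
  have hfK : ∀ x (h : x ∈ K), f x = T ⟨x, h⟩ := fun x h => by simp only [hf, dif_pos h]
  have hmaps : Set.MapsTo f K K := fun x hx => by rw [hfK x hx]; exact (T _).2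
  obtain ⟨L, hLK, hLne, hLconv, hLc, hLf, hmin⟩ :=
    exists_minimal_invariant hKne hKconv hK hmaps
  obtain ⟨u, p, ρ, x, l, hρ, hLρ, hp, hx, hnull, hlim⟩ :=
    S.exists_center_of_minimal hsum hLne hLconv hLc hLf
      (fun x hx y hy => by
        rw [hfK x (hLK hx), hfK y (hLK hy)]
        exact hT _ _) hmin
      (fun x hx h => hTfix ⟨x, hLK hx⟩ (Subtype.ext (by rw [← hfK x (hLK hx)]; exact h)))
  obtain ⟨C, hC1, hC2, hC3⟩ := S.exists_infinite_of_sphere hsum hLconv hρ hLρ hp hx hnull hlim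
  refine ⟨C, hC1, fun e he => ?_, hC3⟩
  obtain ⟨i, rfl | rfl⟩ := hC2 e he
  · exact hGE i.2
  · exact hneg _ (hGE i.2)

end Main

theorem mainTheorem2 (X : Type u) [NormedAddCommGroup X] [NormedSpace ℝ X] [CompleteSpace X]
    [TopologicalSpace.SeparableSpace X] (hX : IsLindenstraussSpace.{u, v} X) :
    HasWeakStarFPP X ↔
      ¬ ∃ C : Set (StrongDual ℝ X), C.Infinite ∧
        C ⊆ Set.extremePoints ℝ (Metric.closedBall (0 : StrongDual ℝ X) 1) ∧
        weakStarClosure (convexHull ℝ C) ⊆ Metric.sphere (0 : StrongDual ℝ X) 1 := by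
  have hat : ∀ e ∈ Set.extremePoints ℝ (Metric.closedBall (0 : StrongDual ℝ X) 1), e ≠ 0 →
      IsLAtom e := fun e he he0 => hX.isLAtom he he0
  constructor
  · rintro hF ⟨C, hC1, hC2, hC3⟩
    exact not_hasWeakStarFPP_of_infinite hat hC1 hC2 hC3 hF
  · intro h
    by_contra hF
    exact h (exists_infinite_of_not_hasWeakStarFPP hat hF)
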